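/- For positive integers $l_1,\dots,l_n$ with $l_1>1$ let $\zeta(l_1,\dots,l_n)=\sum_{m_1>\dots>m_n\ge 1}\frac{1}{m_1^{l_1}\cdots m_n^{l_n}}$ be the multiple zeta value, and let $$\zeta^t(l_1,\dots,l_n)=\sum_{\mathbf p=(l_1\Box l_2\Box\cdots\Box l_n)} t^{\,n-\mathrm{dep}(\mathbf p)}\,\zeta(\mathbf p)\in\mathbb R[t]$$ be the interpolated multiple zeta value, where the sum runs over all $2^{n-1}$ ways of replacing each $\Box$ by "," or by "+", and $\mathrm{dep}(\mathbf p)$ is the number of entries of $\mathbf p$. Write $\{1\}^k$ for $k$ consecutive entries $1$, let $\delta$ be the Kronecker delta, and let $\binom{n}{k}=0$ unless $0\le k\le n$. Terms whose coefficient is $0$ are omitted, and all $\alpha_j$ below run over nonnegative integers. **Theorem.** For any positive integers $a,b,r,s$, the following identity holds in $\mathbb R[t]$: $$\begin{aligned} &\zeta^t(a+1,\{1\}^{r-1})\,\zeta^t(b+1,\{1\}^{s-1})\\ &=\sum_{\alpha_1+\dots+\alpha_{r+s}=a+b}\Big\{\sum_{l=1}^{r}\binom{\alpha_1}{a}\binom{r+s-l-1}{r-l}\prod_{j=l+2}^{r+s}\delta_{\alpha_j,0}+\sum_{l=1}^{s}\binom{\alpha_1}{b}\binom{r+s-l-1}{s-l}\prod_{j=l+2}^{r+s}\delta_{\alpha_j,0}\Big\}\,\zeta^t(\alpha_1+1,\dots,\alpha_{r+s}+1)\\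 &\quad-t\Big[\sum_{l=1}^{r-1}\ \sum_{\alpha_1+\dots+\alpha_{l+1}=a+b}\ \sum_{i=\min\{r-l,\,s-1\}-1}^{r+s-l-3}\binom{\alpha_1}{a}\Big\{\binom{i}{r-l-1}+\binom{i}{s-2}\Big\}\,\zeta^t(\alpha_1+1,\dots,\alpha_{l+1}+1,\{1\}^{i},2,\{1\}^{r+s-l-i-3})\\ &\qquad+\sum_{l=1}^{s-1}\ \sum_{\alpha_1+\dots+\alpha_{l+1}=a+b}\ \sum_{i=\min\{r-1,\,s-l\}-1}^{r+s-l-3}\binom{\alpha_1}{b}\Big\{\binom{i}{s-l-1}+\binom{i}{r-2}\Big\}\,\zeta^t(\alpha_1+1,\dots,\alpha_{l+1}+1,\{1\}^{i},2,\{1\}^{r+s-l-i-3})\Big]\\ &\quad-t\Big[\delta_{s,1}\sum_{l=1}^{r-1}\ \sum_{\alpha_1+\dots+\alpha_{l+1}=a+b}\binom{\alpha_1}{a}\,\zeta^t(\alpha_1+1,\dots,\alpha_l+1,\alpha_{l+1}+2,\{1\}^{r-l-1})\\ &\qquad+\delta_{r,1}\sum_{l=1}^{s-1}\ \sum_{\alpha_1+\dots+\alpha_{l+1}=a+b}\binom{\alpha_1}{b}\,\zeta^t(\alpha_1+1,\dots,\alpha_l+1,\alpha_{l+1}+2,\{1\}^{s-l-1})\\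 &\qquad+\sum_{\alpha_1+\dots+\alpha_{r+1}=a+b}\binom{\alpha_1}{a}\,\zeta^t(\alpha_1+1,\dots,\alpha_{r-1}+1,\alpha_r+\alpha_{r+1}+2,\{1\}^{s-1})\\ &\qquad+\sum_{\alpha_1+\dots+\alpha_{s+1}=a+b}\binom{\alpha_1}{b}\,\zeta^t(\alpha_1+1,\dots,\alpha_{s-1}+1,\alpha_s+\alpha_{s+1}+2,\{1\}^{r-1})\Big]. \end{aligned}$$ -/

import Mathlib

open Polynomial

/-- The multiple zeta value of an index `l = (l₁, …, lₙ)`: the sum of `1 / (m₁ ^ l₁ ⋯ mₙ ^ lₙ)` over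
all `m₁ > m₂ > ⋯ > mₙ ≥ 1`. The series converges for positive entries with `l₁ ≥ 2`; the empty
index has value `1`. -/
noncomputable def mzv (l : List ℕ) : ℝ :=
  ∑' m : {m : Fin l.length → ℕ // StrictAnti m ∧ ∀ i, 1 ≤ m i},
    ∏ i : Fin l.length, 1 / ((m.1 i : ℕ) : ℝ) ^ l.get i

/-- All `2 ^ (n - 1)` ways of filling the boxes in `a □ l₁ □ ⋯ □ lₙ₋₁` by `,` or `+`
(one list entry for every filling). -/
def boxFillingsCons : ℕ → List ℕ → List (List ℕ)
  | a, [] => [[a]]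
  | a, b :: l => (boxFillingsCons b l).map (fun p => a :: p) ++ boxFillingsCons (a + b) l

/-- All ways of filling the boxes in `l₁ □ l₂ □ ⋯ □ lₙ` by `,` or `+`. -/
def boxFillings : List ℕ → List (List ℕ)
  | [] => [[]]
  | a :: l => boxFillingsCons a l

/-- The interpolated multiple zeta value `ζᵗ(l)`, a real polynomial in the variable `t = X`. -/
noncomputable def imzv (l : List ℕ) : ℝ[X] :=
  ((boxFillings l).map fun p => X ^ (l.length - p.length) * C (mzv p)).sum

/-- The binomial coefficient for integer arguments, equal to `0` unless `0 ≤ k ≤ n`. -/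
def intBinom (n k : ℤ) : ℕ :=
  if 0 ≤ k ∧ k ≤ n then n.toNat.choose k.toNat else 0

/-- Kronecker's delta. -/
def kronecker (m n : ℕ) : ℕ := if m = n then 1 else 0

/-!
The identity is an identity of shuffle products. In letters `x = dz / z` and `y = dz / (1 - z)`, the
multiple zeta value of `(l₁, …, lₙ)` is the iterated integral of the word
`x ^ (l₁ - 1) y ⋯ x ^ (lₙ - 1) y` from `0` to `1`. Summing over box fillings replaces every `y` except
the last by `p = y + t x`, so that `ζᵗ(a + 1, {1}ʳ⁻¹)` belongs to the word `x ^ a p ^ (r - 1) y`. Hence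
the product on the left is given by the shuffles of `x ^ a p ^ (r - 1) y` with `x ^ b p ^ (s - 1) y`.
In these shuffles one of the two letters `y` is no longer at the end; writing it as `y = p - t x`
gives the words on the right: the part with `p` gives the leading sum, the part with `x` the
correction terms with the factor `t`.

*Analysis.* Iterated integrals are taken of formal power series: `formOp ω` sends `f` to
`∫ ω f dz / z`, coefficient by coefficient. Integration by parts (`formOp_mul_formOp`) gives the
shuffle product as an identity of power series (`prod_formOp_mul_prod_formOp`). A multiple zeta value
is the sum of the coefficients of its polylogarithm (`hasSum_coeff_polylog`), an interpolated one that
of `interpolatedPolylog` (`hasSum_coeff_interpolatedPolylog`), and sums of coefficients are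
multiplicative by the Cauchy product (`hasSum_coeff_mul`). So no limit `z → 1` has to be taken.

*Combinatorics.* The letters act on power series, and shuffles are summed in the ring of operators
(`shuffleSum`). Shuffles are first sorted by the word that provides the first letter other than `x`
(`shuffleSum_replicate_append`); this splits the right-hand side into two halves that differ by
exchanging `(a, r)` and `(b, s)`. In each half the rest is cut in front of the first `p` of the other
word (`shuffleSum_append_cons`), which gives `shuffleSum_concat_append_succ` and
`shuffleSum_concat_append_singleton`; behind the cut all letters but the last are equal, and only
binomial coefficients remain (`shuffleSum_replicate_concat`). Finally, sums over compositions are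
matched with shuffles of letters `p` and `x` (`sum_interpolatedPolylog_append`).
-/

open Finset.HasAntidiagonal (antidiagonal)

/-! ### Shuffle sums in a noncommutative ring -/

/-- The shuffle product of two words whose letters are elements of a semiring: the sum, over all
shuffles of the two lists, of the product of the letters in the shuffled order. -/
def shuffleSum {A : Type*} [Semiring A] : List A → List A → A
  | [], v => v.prod
  | a :: u, [] => (a :: u).prod
  | a :: u, b :: v => a * shuffleSum u (b :: v) + b * shuffleSum (a :: u) v
termination_by u v => u.length + v.length

section Semiring

variable {A : Type*} [Semiring A]

@[simp] lemma shuffleSum_nil_left (v : List A) : shuffleSum [] v = v.prod := by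
  rw [shuffleSum]

@[simp] lemma shuffleSum_nil_right (u : List A) : shuffleSum u [] = u.prod := by
  cases u <;> rw [shuffleSum]

lemma shuffleSum_cons_cons (a b : A) (u v : List A) :
    shuffleSum (a :: u) (b :: v) = a * shuffleSum u (b :: v) + b * shuffleSum (a :: u) v := by
  rw [shuffleSum]

lemma shuffleSum_comm (u v : List A) : shuffleSum u v = shuffleSum v u := by
  induction u generalizing v with
  | nil => simp
  | cons a u ihu =>
    induction v with
    | nil => simp
    | cons b v ihv => rw [shuffleSum_cons_cons, shuffleSum_cons_cons, ihu, ihv, add_comm]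

/-- A shuffle of `u` with `w ++ q :: v` is cut in front of the letter `q`: the first `l` letters of
`u` are shuffled with `w`, the others with `v`. -/
lemma shuffleSum_append_cons (q : A) (u w v : List A) :
    shuffleSum u (w ++ q :: v) = ∑ l ∈ Finset.range (u.length + 1),
      shuffleSum (u.take l) w * q * shuffleSum (u.drop l) v := by
  induction u generalizing w with
  | nil => simp [mul_assoc]
  | cons a u ihu =>
    induction w with
    | nil =>
      rw [Finset.sum_range_succ', List.nil_append, shuffleSum_cons_cons]
      congr 1
      · have := ihu []
        simp only [List.nil_append] at this
        simp [this, Finset.mul_sum, mul_assoc]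
      · simp
    | cons b w ihw =>
      rw [List.cons_append, shuffleSum_cons_cons, ihw, ← List.cons_append, ihu,
        List.length_cons, Finset.sum_range_succ' _ (u.length + 1),
        Finset.sum_range_succ' _ (u.length + 1)]
      simp only [List.take_succ_cons, List.drop_succ_cons, shuffleSum_cons_cons a b, add_mul,
        Finset.sum_add_distrib, mul_add, Finset.mul_sum]
      simp [mul_assoc, add_assoc]

/-- Shuffles of `q :: u` with `x ^ j`, sorted by the number of letters `x` in front of `q`. -/
lemma shuffleSum_cons_replicate (x q : A) (u : List A) (j : ℕ) :
    shuffleSum (q :: u) (List.replicate j x) =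
      ∑ ij ∈ antidiagonal j, x ^ ij.1 * q * shuffleSum u (List.replicate ij.2 x) := by
  induction j with
  | zero => simp
  | succ j ih =>
    rw [List.replicate_succ, shuffleSum_cons_cons, ih, Finset.Nat.sum_antidiagonal_succ]
    simp [List.replicate_succ, Finset.mul_sum, pow_succ', mul_assoc]

/-- The sum of the shuffles of `x ^ a q u` with `x ^ b w`, where `a + b = c`, in which `q` comes in
front of the first letter of `w`, sorted by the number `i` of letters `x` in front of `q`: there are
`i.choose a` ways to interleave these letters. -/
def shuffleSumFirst (x q : A) (a c : ℕ) (u w : List A) : A :=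
  ∑ ij ∈ antidiagonal c,
    ij.1.choose a • (x ^ ij.1 * q * shuffleSum u (List.replicate ij.2 x ++ w))

lemma shuffleSumFirst_zero_succ (x q : A) (c : ℕ) (u w : List A) :
    shuffleSumFirst x q 0 (c + 1) u w =
      q * shuffleSum u (List.replicate (c + 1) x ++ w) + x * shuffleSumFirst x q 0 c u w := by
  simp [shuffleSumFirst, Finset.Nat.sum_antidiagonal_succ, Finset.mul_sum, pow_succ', mul_assoc]

lemma shuffleSumFirst_succ_succ (x q : A) (a c : ℕ) (u w : List A) :
    shuffleSumFirst x q (a + 1) (c + 1) u w =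
      x * (shuffleSumFirst x q a c u w + shuffleSumFirst x q (a + 1) c u w) := by
  simp [shuffleSumFirst, Finset.Nat.sum_antidiagonal_succ, Finset.mul_sum, pow_succ', mul_assoc,
    Nat.choose_succ_succ, add_smul, Finset.sum_add_distrib, mul_add, -nsmul_eq_mul]

lemma shuffleSumFirst_of_lt (x q : A) {a c : ℕ} (h : c < a) (u w : List A) :
    shuffleSumFirst x q a c u w = 0 := by
  refine Finset.sum_eq_zero fun ij hij => ?_
  have := Finset.HasAntidiagonal.mem_antidiagonal.1 hij
  rw [Nat.choose_eq_zero_of_lt (by omega), zero_smul]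

/-- Shuffles of two words that start with powers of `x`, according to which of the words provides
the first letter after the initial letters `x`. -/
lemma shuffleSum_replicate_append (x q q' : A) (a b : ℕ) (u v : List A) :
    shuffleSum (List.replicate a x ++ q :: u) (List.replicate b x ++ q' :: v) =
      shuffleSumFirst x q a (a + b) u (q' :: v) + shuffleSumFirst x q' b (a + b) v (q :: u) := by
  induction a generalizing b with
  | zero =>
    induction b with
    | zero => simp [shuffleSumFirst, shuffleSum_cons_cons, shuffleSum_comm v]
    | succ b ih =>
      rw [List.replicate_succ, List.cons_append, List.replicate_zero, List.nil_append,
        shuffleSum_cons_cons, ← List.cons_append, ← List.replicate_succ]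
      rw [List.replicate_zero, List.nil_append] at ih
      rw [ih, ← add_assoc 0 b, shuffleSumFirst_zero_succ, shuffleSumFirst_succ_succ,
        shuffleSumFirst_of_lt x q' (by omega : 0 + b < b + 1), zero_add, add_zero]
      simp only [mul_add]
      abel
  | succ a iha =>
    induction b with
    | zero =>
      have e : shuffleSum (List.replicate (a + 1) x ++ q :: u) (q' :: v) =
          x * shuffleSum (List.replicate a x ++ q :: u) (q' :: v) +
            q' * shuffleSum (List.replicate (a + 1) x ++ q :: u) v := by
        rw [List.replicate_succ, List.cons_append, shuffleSum_cons_cons]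
      rw [List.replicate_zero, List.nil_append, e]
      have iha := iha 0
      rw [List.replicate_zero, List.nil_append] at iha
      rw [iha, add_zero, add_zero, shuffleSumFirst_zero_succ, shuffleSumFirst_succ_succ,
        shuffleSumFirst_of_lt x q (by omega : a < a + 1), add_zero, shuffleSum_comm v]
      simp only [mul_add]
      abel
    | succ b ihb =>
      rw [List.replicate_succ (n := a), List.replicate_succ (n := b), List.cons_append,
        List.cons_append, shuffleSum_cons_cons, ← List.cons_append, ← List.cons_append,
        ← List.replicate_succ, ← List.replicate_succ, iha, ihb,
        show a + 1 + (b + 1) = a + b + 1 + 1 by omega, show a + (b + 1) = a + b + 1 by omega,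
        show a + 1 + b = a + b + 1 by omega, shuffleSumFirst_succ_succ x q a (a + b + 1),
        shuffleSumFirst_succ_succ x q' b (a + b + 1)]
      simp only [mul_add]
      abel

end Semiring

section Ring

variable {R A : Type*} [CommRing R] [Ring A] [Algebra R A]

lemma shuffleSum_append_sub_smul (t : R) (a b : A) (u w : List A) :
    shuffleSum (u ++ [a - t • b]) w =
      shuffleSum (u ++ [a]) w - t • shuffleSum (u ++ [b]) w := by
  induction u generalizing w with
  | nil =>
    induction w with
    | nil => simp
    | cons c w ih =>
      rw [List.nil_append] at ih ⊢
      rw [shuffleSum_cons_cons, ih, List.nil_append, List.nil_append, shuffleSum_cons_cons,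
        shuffleSum_cons_cons]
      simp only [shuffleSum_nil_left, sub_mul, mul_sub, smul_add, smul_mul_assoc, mul_smul_comm]
      abel
  | cons d u ihu =>
    induction w with
    | nil => simp [mul_sub]
    | cons c w ihw =>
      simp only [List.cons_append] at ihw ⊢
      simp only [shuffleSum_cons_cons, ihw, ihu, mul_sub, smul_add, mul_smul_comm]
      abel

variable {t : R} {x p y : A}

/-- All letters but the last are equal, so the two last letters `y = p - t x` account for everything
but a binomial coefficient: the first of them is the `x` in the correction term. -/
lemma shuffleSum_replicate_concat (hy : y = p - t • x) (k n : ℕ) :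
    shuffleSum (List.replicate k p ++ [y]) (List.replicate n p ++ [y]) =
      (k + n + 2).choose (k + 1) • (p ^ (k + n + 1) * y) -
        t • ∑ i ∈ Finset.range (k + n + 1),
          (i.choose k + i.choose n) • (p ^ i * x * p ^ (k + n - i) * y) := by
  have hyz (z : A) : y * z = p * z - t • (x * z) := by rw [hy, sub_mul, smul_mul_assoc]
  have base (n : ℕ) : shuffleSum [y] (List.replicate n p ++ [y]) =
      (n + 2) • (p ^ (n + 1) * y) -
        t • ∑ i ∈ Finset.range (n + 1),
          (1 + i.choose n) • (p ^ i * x * p ^ (n - i) * y) := by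
    induction n with
    | zero =>
      simp only [List.replicate_zero, List.nil_append, shuffleSum_cons_cons, shuffleSum_nil_left,
        shuffleSum_nil_right, List.prod_singleton, hyz y]
      simp [-nsmul_eq_mul]
      module
    | succ n ih =>
      rw [List.replicate_succ, List.cons_append, shuffleSum_cons_cons, ih,
        Finset.sum_range_succ' _ (n + 1), shuffleSum_nil_left, hyz]
      have e : ∀ i ∈ Finset.range (n + 1),
          (1 + (i + 1).choose (n + 1)) • (p ^ (i + 1) * x * p ^ (n + 1 - (i + 1)) * y) =
            p * ((1 + i.choose n) • (p ^ i * x * p ^ (n - i) * y)) := by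
        intro i hi
        rw [Nat.choose_succ_succ, Nat.choose_eq_zero_of_lt (k := n + 1) (by simpa using hi),
          add_zero, Nat.add_sub_add_right, mul_smul_comm]
        simp only [pow_succ', mul_assoc]
      rw [Finset.sum_congr rfl e, ← Finset.mul_sum]
      simp only [mul_sub, mul_smul_comm, List.prod_cons, List.prod_append, List.prod_replicate,
        List.prod_nil, mul_one, pow_succ' p (n + 1), mul_assoc, pow_zero, one_mul,
        Nat.choose_zero_succ, Nat.sub_zero]
      rw [pow_succ', mul_assoc]
      module
  induction k generalizing n with
  | zero => simpa [add_comm, add_left_comm, add_assoc] using base n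
  | succ k ihk =>
    induction n with
    | zero =>
      rw [List.replicate_zero, List.nil_append, shuffleSum_comm, base]
      simp [add_comm, add_left_comm, add_assoc]
    | succ n ihn =>
      rw [List.replicate_succ, List.replicate_succ (n := n), List.cons_append, List.cons_append,
        shuffleSum_cons_cons, ← List.cons_append, ← List.cons_append, ← List.replicate_succ,
        ← List.replicate_succ, ihk, ihn, show k + 1 + (n + 1) = k + n + 1 + 1 by omega,
        Finset.sum_range_succ' _ (k + n + 1 + 1), show k + (n + 1) = k + n + 1 by omega,
        show k + 1 + n = k + n + 1 by omega,
        show (k + n + 1 + 1 + 2).choose (k + 1 + 1) =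
          (k + n + 1 + 2).choose (k + 1) + (k + n + 1 + 2).choose (k + 1 + 1) from
          Nat.choose_succ_succ _ _]
      have e : ∀ i ∈ Finset.range (k + n + 1 + 1),
          ((i + 1).choose (k + 1) + (i + 1).choose (n + 1)) •
              (p ^ (i + 1) * x * p ^ (k + n + 1 + 1 - (i + 1)) * y) =
            p * ((i.choose k + i.choose (n + 1)) • (p ^ i * x * p ^ (k + n + 1 - i) * y)) +
            p * ((i.choose (k + 1) + i.choose n) • (p ^ i * x * p ^ (k + n + 1 - i) * y)) := by
        intro i _
        rw [Nat.choose_succ_succ, Nat.choose_succ_succ i n, Nat.add_sub_add_right]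
        simp only [mul_smul_comm, pow_succ', mul_assoc]
        module
      rw [Finset.sum_congr rfl e, Finset.sum_add_distrib, ← Finset.mul_sum, ← Finset.mul_sum]
      simp only [mul_sub, mul_smul_comm, Nat.choose_zero_succ, add_zero, zero_smul,
        pow_succ' p (k + n + 1 + 1), mul_assoc]
      module

/-- The shuffles of `p ^ m y` with `x ^ j p ^ (n + 1) y`, cut in front of the first `p` of the second
word and written as words that end in `y` and are otherwise free of `y`. In front of the cut there
are all `j` letters `x` of the second word and either `l` letters `p` of the first word (the summand
of index `l ≤ m`) or the whole first word, whose `y = p - t x` then gives the summand `l = m + 1` and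
the last correction term. -/
lemma shuffleSum_concat_append_succ (hy : y = p - t • x) (m j n : ℕ) :
    shuffleSum (List.replicate m p ++ [y])
        (List.replicate j x ++ (List.replicate (n + 1) p ++ [y])) =
      ∑ l ∈ Finset.range (m + 2), (m + n + 2 - l).choose (m + 1 - l) •
        (shuffleSum (List.replicate l p) (List.replicate j x) * p ^ (m + n + 2 - l) * y) -
      t • ∑ l ∈ Finset.range (m + 1), ∑ i ∈ Finset.range (m - l + n + 1),
        (i.choose (m - l) + i.choose n) •
          (shuffleSum (List.replicate l p) (List.replicate j x) *
            p ^ (i + 1) * x * p ^ (m - l + n - i) * y) -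
      t • (shuffleSum (List.replicate m p ++ [x]) (List.replicate j x) * p ^ (n + 1) * y) := by
  rw [List.replicate_succ, List.cons_append, shuffleSum_append_cons, List.length_append,
    List.length_replicate, List.length_singleton, Finset.sum_range_succ,
    Finset.sum_range_succ _ (m + 1)]
  have e : ∀ l ∈ Finset.range (m + 1),
      shuffleSum ((List.replicate m p ++ [y]).take l) (List.replicate j x) * p *
        shuffleSum ((List.replicate m p ++ [y]).drop l) (List.replicate n p ++ [y]) =
      (m + n + 2 - l).choose (m + 1 - l) •
        (shuffleSum (List.replicate l p) (List.replicate j x) * p ^ (m + n + 2 - l) * y) -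
      t • ∑ i ∈ Finset.range (m - l + n + 1),
        (i.choose (m - l) + i.choose n) •
          (shuffleSum (List.replicate l p) (List.replicate j x) *
            p ^ (i + 1) * x * p ^ (m - l + n - i) * y) := by
    intro l hl
    have hl : l ≤ m := by simpa [Nat.lt_succ_iff] using hl
    rw [List.take_append_of_le_length (by simpa), List.drop_append_of_le_length (by simpa),
      List.take_replicate, List.drop_replicate, min_eq_left hl, shuffleSum_replicate_concat hy,
      show m - l + n + 2 = m + n + 2 - l by omega, show m - l + 1 = m + 1 - l by omega,
      show m + n + 2 - l = m - l + n + 1 + 1 by omega]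
    simp only [mul_sub, mul_smul_comm, Finset.mul_sum, pow_succ', mul_assoc]
  rw [Finset.sum_congr rfl e, Finset.sum_sub_distrib, ← Finset.smul_sum, List.take_of_length_le
    (by simp), List.drop_of_length_le (by simp), hy, shuffleSum_append_sub_smul, ← hy,
    ← List.replicate_succ', show m + n + 2 - (m + 1) = n + 1 by omega, Nat.sub_self]
  simp only [shuffleSum_nil_left, List.prod_append, List.prod_replicate, List.prod_singleton,
    sub_mul, smul_mul_assoc, Nat.choose_zero_right, one_smul, pow_succ', mul_assoc]
  abel

/-- The variant of `shuffleSum_concat_append_succ` in which the second word has no letter `p`, so that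
the cut is in front of its final `y`, which is to be rewritten as well. -/
lemma shuffleSum_concat_append_singleton (hy : y = p - t • x) (m j : ℕ) :
    shuffleSum (List.replicate m p ++ [y]) (List.replicate j x ++ [y]) =
      ∑ l ∈ Finset.range (m + 2),
        shuffleSum (List.replicate l p) (List.replicate j x) * p ^ (m + 1 - l) * y -
      t • ∑ l ∈ Finset.range (m + 1),
        shuffleSum (List.replicate l p) (List.replicate j x) * x * p ^ (m - l) * y -
      t • (shuffleSum (List.replicate m p ++ [x]) (List.replicate j x) * y) := by
  rw [shuffleSum_append_cons, List.length_append,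
    List.length_replicate, List.length_singleton, Finset.sum_range_succ,
    Finset.sum_range_succ _ (m + 1)]
  have e : ∀ l ∈ Finset.range (m + 1),
      shuffleSum ((List.replicate m p ++ [y]).take l) (List.replicate j x) * y *
        shuffleSum ((List.replicate m p ++ [y]).drop l) [] =
        shuffleSum (List.replicate l p) (List.replicate j x) * p ^ (m + 1 - l) * y -
      t • (shuffleSum (List.replicate l p) (List.replicate j x) * x * p ^ (m - l) * y) := by
    intro l hl
    have hl : l ≤ m := by simpa [Nat.lt_succ_iff] using hl
    rw [List.take_append_of_le_length (by simpa), List.drop_append_of_le_length (by simpa),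
      List.take_replicate, List.drop_replicate, min_eq_left hl, shuffleSum_nil_right,
      List.prod_append, List.prod_replicate, List.prod_singleton,
      show m + 1 - l = m - l + 1 by omega, pow_succ']
    nth_rw 1 [hy]
    simp only [mul_sub, sub_mul, mul_smul_comm, smul_mul_assoc, mul_assoc]
  rw [Finset.sum_congr rfl e, Finset.sum_sub_distrib, ← Finset.smul_sum, List.take_of_length_le
    (by simp), List.drop_of_length_le (by simp), hy, shuffleSum_append_sub_smul, ← hy,
    ← List.replicate_succ', Nat.sub_self]
  simp only [shuffleSum_nil_left, List.prod_nil, sub_mul, smul_mul_assoc, pow_zero, mul_one]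
  abel

end Ring

/-! ### Iterated integrals of power series -/

/-- Termwise `∫ f dz/z`: the coefficient of `z ^ n` is divided by `n`. The constant term, which would
give a logarithm, is discarded. -/
noncomputable def integrate : Module.End ℝ (PowerSeries ℝ) where
  toFun f := PowerSeries.mk fun n => PowerSeries.coeff n f / n
  map_add' f g := by ext n; simp [add_div]
  map_smul' c f := by ext n; simp [mul_div_assoc]

/-- The operator `f ↦ ∫ ω f dz/z` on power series. -/
noncomputable def formOp (ω : PowerSeries ℝ) : Module.End ℝ (PowerSeries ℝ) :=
  integrate * LinearMap.mulLeft ℝ ω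

/-- The power series `z / (1 - z)`, for which `formOp` integrates against `dz / (1 - z)`. -/
noncomputable def geomSeries : PowerSeries ℝ := PowerSeries.mk fun n => if n = 0 then 0 else 1

lemma coeff_integrate (f : PowerSeries ℝ) (n : ℕ) :
    PowerSeries.coeff n (integrate f) = PowerSeries.coeff n f / n := by
  simp [integrate]

lemma coeff_formOp (ω f : PowerSeries ℝ) (n : ℕ) :
    PowerSeries.coeff n (formOp ω f) = PowerSeries.coeff n (ω * f) / n := by
  simp [formOp, coeff_integrate]

lemma formOp_add_smul (ω η : PowerSeries ℝ) (t : ℝ) :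
    formOp (ω + t • η) = formOp ω + t • formOp η := by
  ext f n
  simp [coeff_formOp, add_mul, add_div, mul_div_assoc]

@[simp] lemma constantCoeff_formOp (ω f : PowerSeries ℝ) :
    PowerSeries.constantCoeff (formOp ω f) = 0 := by
  rw [← PowerSeries.coeff_zero_eq_constantCoeff_apply, coeff_formOp]
  simp

/-- The derivation `z d/dz` of power series, inverse to `integrate` on series without constant
term. -/
noncomputable def eulerDerivation : Derivation ℝ (PowerSeries ℝ) (PowerSeries ℝ) :=
  (PowerSeries.X : PowerSeries ℝ) • PowerSeries.derivative ℝ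

lemma coeff_eulerDerivation (f : PowerSeries ℝ) (n : ℕ) :
    PowerSeries.coeff n (eulerDerivation f) = n * PowerSeries.coeff n f := by
  cases n with
  | zero => simp [eulerDerivation]
  | succ n =>
    simp [eulerDerivation, PowerSeries.coeff_succ_X_mul, PowerSeries.coeff_derivative, mul_comm]

lemma integrate_eulerDerivation {f : PowerSeries ℝ} (hf : PowerSeries.constantCoeff f = 0) :
    integrate (eulerDerivation f) = f := by
  ext n
  rw [coeff_integrate, coeff_eulerDerivation]
  cases n with
  | zero => simp [hf]
  | succ n => field_simp

lemma eulerDerivation_formOp {ω f : PowerSeries ℝ} (h : PowerSeries.constantCoeff (ω * f) = 0) :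
    eulerDerivation (formOp ω f) = ω * f := by
  ext n
  rw [coeff_eulerDerivation, coeff_formOp]
  cases n with
  | zero => simpa using h.symm
  | succ n => field_simp

/-- Integration by parts. -/
lemma formOp_mul_formOp {ω η f g : PowerSeries ℝ} (hf : PowerSeries.constantCoeff (ω * f) = 0)
    (hg : PowerSeries.constantCoeff (η * g) = 0) :
    formOp ω f * formOp η g = formOp ω (f * formOp η g) + formOp η (formOp ω f * g) := by
  rw [← integrate_eulerDerivation (f := formOp ω f * formOp η g) (by simp), Derivation.leibniz,
    eulerDerivation_formOp hf, eulerDerivation_formOp hg, map_add]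
  simp only [smul_eq_mul, formOp, Module.End.mul_apply, LinearMap.mulLeft_apply]
  rw [add_comm]
  congr 2 <;> ring

/-- Iterated integrals multiply by shuffling, provided that the innermost integrals, whose integrand
involves no inner integral, are of forms without constant term. -/
lemma prod_formOp_mul_prod_formOp (u v : List (PowerSeries ℝ))
    (hu : ∀ ω ∈ u.getLast?, PowerSeries.constantCoeff ω = 0)
    (hv : ∀ ω ∈ v.getLast?, PowerSeries.constantCoeff ω = 0) :
    (u.map formOp).prod 1 * (v.map formOp).prod 1 =
      shuffleSum (u.map formOp) (v.map formOp) 1 := by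
  have key (ω : PowerSeries ℝ) (w : List (PowerSeries ℝ))
      (h : ∀ η ∈ (ω :: w).getLast?, PowerSeries.constantCoeff η = 0) :
      PowerSeries.constantCoeff (ω * (w.map formOp).prod 1) = 0 := by
    cases w with
    | nil => simpa using h
    | cons η w => simp
  have tail (ω : PowerSeries ℝ) (w : List (PowerSeries ℝ))
      (h : ∀ η ∈ (ω :: w).getLast?, PowerSeries.constantCoeff η = 0) :
      ∀ η ∈ w.getLast?, PowerSeries.constantCoeff η = 0 := by
    cases w with
    | nil => simp
    | cons η w => simpa [List.getLast?_cons_cons] using h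
  induction u generalizing v with
  | nil => simp
  | cons ω u ihu =>
    induction v with
    | nil => simp
    | cons η v ihv =>
      have h1 := ihu (η :: v) (tail ω u hu) hv
      have h2 := ihv (tail η v hv)
      simp only [List.map_cons, List.prod_cons, Module.End.mul_apply] at h1 h2 ⊢
      rw [formOp_mul_formOp (key ω u hu) (key η v hv), h1, h2, shuffleSum_cons_cons]
      simp

/-! ### Multiple zeta values as sums of coefficients -/

lemma coeff_formOp_one_pow (j : ℕ) (f : PowerSeries ℝ) (n : ℕ) :
    PowerSeries.coeff n ((formOp 1 ^ j) f) = PowerSeries.coeff n f / (n : ℝ) ^ j := by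
  induction j with
  | zero => simp
  | succ j ih =>
    rw [pow_succ', Module.End.mul_apply, coeff_formOp, one_mul, ih, pow_succ, div_div]

lemma coeff_formOp_geomSeries (f : PowerSeries ℝ) (n : ℕ) :
    PowerSeries.coeff n (formOp geomSeries f) =
      (∑ m ∈ Finset.range n, PowerSeries.coeff m f) / n := by
  rw [coeff_formOp]
  cases n with
  | zero => simp
  | succ n =>
    congr 1
    rw [mul_comm, PowerSeries.coeff_mul, Finset.Nat.sum_antidiagonal_eq_sum_range_succ_mk,
      Finset.sum_range_succ]
    simp only [geomSeries, PowerSeries.coeff_mk, Nat.sub_self, if_true, mul_zero, add_zero]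
    refine Finset.sum_congr rfl fun m hm => ?_
    have := Finset.mem_range.1 hm
    rw [if_neg (by omega), mul_one]

/-- The multiple polylogarithm `∑ z ^ m₁ / (m₁ ^ l₁ ⋯ mₙ ^ lₙ)` as a power series in `z`, for
positive entries `lᵢ`. -/
noncomputable def polylog : List ℕ → PowerSeries ℝ
  | [] => 1
  | k :: l => (formOp 1 ^ (k - 1)) (formOp geomSeries (polylog l))

lemma coeff_polylog_cons {k : ℕ} (hk : 1 ≤ k) (l : List ℕ) (n : ℕ) :
    PowerSeries.coeff n (polylog (k :: l)) =
      1 / (n : ℝ) ^ k * ∑ m ∈ Finset.range n, PowerSeries.coeff m (polylog l) := by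
  obtain ⟨k, rfl⟩ := Nat.exists_eq_add_of_le' hk
  rw [polylog, coeff_formOp_one_pow, coeff_formOp_geomSeries, Nat.add_sub_cancel, div_div,
    ← pow_succ', one_div, div_eq_inv_mul]

lemma coeff_polylog_nonneg (l : List ℕ) (n : ℕ) : 0 ≤ PowerSeries.coeff n (polylog l) := by
  induction l generalizing n with
  | nil => rw [polylog, PowerSeries.coeff_one]; positivity
  | cons k l ih =>
    rw [polylog, coeff_formOp_one_pow, coeff_formOp_geomSeries]
    have := Finset.sum_nonneg fun m (_ : m ∈ Finset.range n) => ih m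
    positivity

/-- The indices of summation of a multiple zeta value of depth `k` that lie below `N`. -/
def mzvIndices (k N : ℕ) : Finset (Fin k → ℕ) :=
  {m ∈ Fintype.piFinset fun _ => Finset.range N | StrictAnti m ∧ ∀ i, 1 ≤ m i}

lemma mem_mzvIndices {k N : ℕ} {m : Fin k → ℕ} :
    m ∈ mzvIndices k N ↔ (∀ i, m i < N) ∧ StrictAnti m ∧ ∀ i, 1 ≤ m i := by
  simp [mzvIndices]

lemma strictAnti_fin_cons {k n : ℕ} {m : Fin k → ℕ} :
    StrictAnti (Fin.cons n m : Fin (k + 1) → ℕ) ↔ (∀ i, m i < n) ∧ StrictAnti m := by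
  constructor
  · intro h
    exact ⟨fun i => by simpa using h (Fin.succ_pos i),
      fun i j hij => by simpa using h (Fin.succ_lt_succ_iff.2 hij)⟩
  · rintro ⟨h1, h2⟩ i j hij
    cases j using Fin.cases with
    | zero => exact absurd hij (Fin.not_lt_zero i)
    | succ j =>
      cases i using Fin.cases with
      | zero => simpa using h1 j
      | succ i => simpa using h2 (Fin.succ_lt_succ_iff.1 hij)

lemma sum_mzvIndices_succ {M : Type*} [AddCommMonoid M] (k N : ℕ) (f : (Fin (k + 1) → ℕ) → M) :
    ∑ m ∈ mzvIndices (k + 1) N, f m =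
      ∑ n ∈ Finset.Ico 1 N, ∑ m ∈ mzvIndices k n, f (Fin.cons n m) := by
  rw [Finset.sum_sigma']
  refine Finset.sum_bij' (fun m _ => (⟨m 0, Fin.tail m⟩ : (_ : ℕ) × (Fin k → ℕ)))
    (fun q _ => Fin.cons q.1 q.2) ?_ ?_ ?_ ?_ ?_
  · intro m hm
    rw [← Fin.cons_self_tail m, mem_mzvIndices, strictAnti_fin_cons] at hm
    simp only [Fin.forall_fin_succ, Fin.cons_zero, Fin.cons_succ] at hm
    simp only [Finset.mem_sigma, Finset.mem_Ico, mem_mzvIndices]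
    tauto
  · rintro ⟨n, m⟩ hm
    simp only [Finset.mem_sigma, Finset.mem_Ico, mem_mzvIndices] at hm
    rw [mem_mzvIndices, strictAnti_fin_cons]
    simp only [Fin.forall_fin_succ, Fin.cons_zero, Fin.cons_succ]
    exact ⟨⟨hm.1.2, fun i => (hm.2.1 i).trans hm.1.2⟩, ⟨hm.2.1, hm.2.2.1⟩, hm.1.1, hm.2.2.2⟩
  · intro m _
    exact Fin.cons_self_tail m
  · rintro ⟨n, m⟩ _
    simp
  · intro m _
    simp

/-- Truncated multiple zeta values are partial sums of polylogarithm coefficients. The condition on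
`N` is needed for the empty index. -/
lemma sum_mzvIndices_eq (l : List ℕ) (hl : ∀ k ∈ l, 1 ≤ k) {N : ℕ} (hN : 1 ≤ N) :
    ∑ m ∈ mzvIndices l.length N, ∏ i : Fin l.length, 1 / ((m i : ℕ) : ℝ) ^ l.get i =
      ∑ n ∈ Finset.range N, PowerSeries.coeff n (polylog l) := by
  induction l generalizing N with
  | nil =>
    obtain ⟨N, rfl⟩ := Nat.exists_eq_add_of_le' hN
    have : mzvIndices 0 (N + 1) = Finset.univ := by
      ext m
      simp only [mem_mzvIndices, IsEmpty.forall_iff, Subsingleton.strictAnti m, and_self,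
        Finset.mem_univ]
    rw [Finset.sum_range_succ']
    simp [polylog, this, PowerSeries.coeff_one]
  | cons k l ih =>
    have hk : 1 ≤ k := hl k (by simp)
    rw [← Finset.sum_sdiff (Finset.range_subset_range.2 hN)]
    have h0 : ∑ n ∈ Finset.range 1, PowerSeries.coeff n (polylog (k :: l)) = 0 := by
      rw [Finset.sum_range_one, coeff_polylog_cons hk]
      simp
    have e : Finset.range N \ Finset.range 1 = Finset.Ico 1 N := by
      ext n; simp; omega
    rw [h0, add_zero, e]
    refine (sum_mzvIndices_succ l.length N _).trans (Finset.sum_congr rfl fun n hn => ?_)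
    rw [coeff_polylog_cons hk, ← ih (fun j hj => hl j (by simp [hj])) (Finset.mem_Ico.1 hn).1,
      Finset.mul_sum]
    refine Finset.sum_congr rfl fun m _ => ?_
    exact Fin.prod_univ_succ _

/-- A crude bound, which suffices for convergence: the exponent `1 / 2` is preserved by the recursion,
since `∑ 1 / √n` is of order `√N`. -/
lemma sum_coeff_polylog_le (l : List ℕ) (hl : ∀ k ∈ l, 1 ≤ k) (N : ℕ) :
    ∑ n ∈ Finset.range N, PowerSeries.coeff n (polylog l) ≤ 3 ^ l.length * √N := by
  induction l generalizing N with
  | nil =>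
    cases N with
    | zero => simp
    | succ N =>
      rw [Finset.sum_range_succ']
      simp [polylog, PowerSeries.coeff_one, Real.one_le_sqrt]
  | cons k l ih =>
    have hk : 1 ≤ k := hl k (by simp)
    induction N with
    | zero => simp
    | succ N ihN =>
      rw [Finset.sum_range_succ, coeff_polylog_cons hk]
      have h1 := ih (fun j hj => hl j (by simp [hj])) N
      rcases Nat.eq_zero_or_pos N with rfl | hN
      · simp
      have hN' : (0 : ℝ) < N := by exact_mod_cast hN
      have hN1 : (1 : ℝ) ≤ N := by exact_mod_cast hN
      have h2 : 1 / (N : ℝ) ^ k * ∑ m ∈ Finset.range N, PowerSeries.coeff m (polylog l) ≤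
          1 / N * (3 ^ l.length * √N) := by
        refine mul_le_mul ?_ h1 (Finset.sum_nonneg fun m _ => coeff_polylog_nonneg l m)
          (by positivity)
        exact one_div_le_one_div_of_le hN' (le_self_pow₀ hN1 (by omega))
      have h3 : 1 / (N : ℝ) * √N ≤ 3 * (√(N + 1 : ℝ) - √N) := by
        have a1 : √(N : ℝ) ^ 2 = N := Real.sq_sqrt hN'.le
        have a2 : √(N + 1 : ℝ) ^ 2 = N + 1 := Real.sq_sqrt (by positivity)
        have a3 : 0 < √(N : ℝ) := Real.sqrt_pos.2 hN'
        have a4 : √(N + 1 : ℝ) ≤ 2 * √N := by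
          rw [Real.sqrt_le_left (by positivity), mul_pow, a1]
          linarith
        have a5 : 1 / (N : ℝ) * √N = 1 / √N := by
          nth_rw 1 [← a1]
          field_simp
        rw [a5, div_le_iff₀ a3]
        nlinarith [Real.sqrt_nonneg (N + 1 : ℝ)]
      have h4 : (0 : ℝ) < 3 ^ l.length := by positivity
      have h5 := mul_le_mul_of_nonneg_left h3 h4.le
      push_cast
      rw [List.length_cons, pow_succ] at *
      linarith

lemma summable_coeff_polylog {k : ℕ} (hk : 2 ≤ k) (l : List ℕ) (hl : ∀ j ∈ l, 1 ≤ j) :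
    Summable fun n => PowerSeries.coeff n (polylog (k :: l)) := by
  have h : Summable fun n : ℕ => 3 ^ l.length * (n : ℝ) ^ (-(3 / 2) : ℝ) :=
    (Real.summable_nat_rpow.2 (by norm_num)).mul_left _
  refine h.of_nonneg_of_le (coeff_polylog_nonneg _) fun n => ?_
  rw [coeff_polylog_cons (by omega)]
  rcases Nat.eq_zero_or_pos n with rfl | hn
  · simp
  have hn' : (0 : ℝ) < n := by exact_mod_cast hn
  have hn1 : (1 : ℝ) ≤ n := by exact_mod_cast hn
  calc 1 / (n : ℝ) ^ k * ∑ m ∈ Finset.range n, PowerSeries.coeff m (polylog l)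
      ≤ 1 / (n : ℝ) ^ 2 * (3 ^ l.length * √n) :=
        mul_le_mul (one_div_le_one_div_of_le (by positivity) (pow_le_pow_right₀ hn1 hk))
          (sum_coeff_polylog_le l hl n) (Finset.sum_nonneg fun m _ => coeff_polylog_nonneg l m)
          (by positivity)
    _ = 3 ^ l.length * (n : ℝ) ^ (-(3 / 2) : ℝ) := by
        rw [Real.sqrt_eq_rpow, one_div, ← Real.rpow_natCast, ← Real.rpow_neg hn'.le,
          mul_left_comm, ← Real.rpow_add hn']
        norm_num

/-- A convergent multiple zeta value is the value at `1` of its multiple polylogarithm. -/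
lemma hasSum_coeff_polylog {k : ℕ} (hk : 2 ≤ k) (l : List ℕ) (hl : ∀ j ∈ l, 1 ≤ j) :
    HasSum (fun n => PowerSeries.coeff n (polylog (k :: l))) (mzv (k :: l)) := by
  have hs := summable_coeff_polylog hk l hl
  have hkl : ∀ j ∈ k :: l, 1 ≤ j := by
    intro j hj
    rcases List.mem_cons.1 hj with rfl | hj
    · omega
    · exact hl j hj
  generalize k :: l = L at hs hkl
  let F : (Fin L.length → ℕ) → ℝ := fun m => ∏ i, 1 / ((m i : ℕ) : ℝ) ^ L.get i
  let S : Set (Fin L.length → ℕ) := {m | StrictAnti m ∧ ∀ i, 1 ≤ m i}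
  have hF (m) : 0 ≤ F m := Finset.prod_nonneg fun i _ => by positivity
  -- the finite sets of indices with entries at most `N` exhaust all indices of summation
  let T : ℕ → Finset S := fun N => (mzvIndices L.length (N + 1)).subtype (· ∈ S)
  have hT (N) : ∑ m ∈ T N, F m = ∑ n ∈ Finset.range (N + 1), PowerSeries.coeff n (polylog L) := by
    rw [← sum_mzvIndices_eq L hkl (by omega)]
    refine Finset.sum_subtype_of_mem F fun m hm => ?_
    exact (mem_mzvIndices.1 hm).2
  have hmono : Monotone T := by
    intro N N' h m hm
    simp only [T, Finset.mem_subtype, mem_mzvIndices] at hm ⊢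
    exact ⟨fun i => (hm.1 i).trans_le (by omega), hm.2⟩
  have htop : Filter.Tendsto T Filter.atTop Filter.atTop := by
    refine Filter.tendsto_atTop_finset_of_monotone hmono fun m => ?_
    refine ⟨∑ i, m.1 i, ?_⟩
    simp only [T, Finset.mem_subtype, mem_mzvIndices]
    exact ⟨fun i => Nat.lt_succ_of_le
      (Finset.single_le_sum (f := m.1) (fun _ _ => Nat.zero_le _) (Finset.mem_univ i)), m.2⟩
  have hsum : Summable fun m : S => F m := by
    refine summable_of_sum_le (fun m => hF m)
      (c := ∑' n, PowerSeries.coeff n (polylog L)) fun u => ?_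
    obtain ⟨N, hN⟩ := (htop.eventually_ge_atTop u).exists
    calc ∑ m ∈ u, F m ≤ ∑ m ∈ T N, F m :=
          Finset.sum_le_sum_of_subset_of_nonneg hN fun m _ _ => hF m
      _ ≤ _ := (hT N).trans_le (hs.sum_le_tsum _ fun n _ => coeff_polylog_nonneg L n)
  have h1 : Filter.Tendsto (fun N => ∑ m ∈ T N, F m) Filter.atTop (nhds (mzv L)) :=
    hsum.hasSum.comp htop
  simp only [hT] at h1
  rw [hs.hasSum_iff_tendsto_nat]
  exact (Filter.tendsto_add_atTop_iff_nat 1).1 h1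

/-! ### Interpolated multiple zeta values -/

/-- The power series whose coefficients add up to the interpolated multiple zeta value at `t`: all
letters `dz / (1 - z)` of the polylogarithm except the innermost are replaced by
`dz / (1 - z) + t dz / z`. -/
noncomputable def interpolatedPolylog (t : ℝ) : List ℕ → PowerSeries ℝ
  | [] => 1
  | [a] => (formOp 1 ^ (a - 1)) (formOp geomSeries 1)
  | a :: b :: l =>
    (formOp 1 ^ (a - 1)) (formOp (geomSeries + t • 1) (interpolatedPolylog t (b :: l)))

lemma exists_eq_cons_of_mem_boxFillingsCons {a : ℕ} {l p : List ℕ} (hl : ∀ j ∈ l, 1 ≤ j)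
    (hp : p ∈ boxFillingsCons a l) :
    ∃ k q, p = k :: q ∧ a ≤ k ∧ (∀ j ∈ q, 1 ≤ j) ∧ q.length ≤ l.length := by
  induction l generalizing a p with
  | nil =>
    simp only [boxFillingsCons, List.mem_singleton] at hp
    exact ⟨a, [], hp, le_rfl, by simp, le_rfl⟩
  | cons b l ih =>
    have hl' : ∀ j ∈ l, 1 ≤ j := fun j hj => hl j (by simp [hj])
    rw [boxFillingsCons, List.mem_append, List.mem_map] at hp
    rcases hp with ⟨p, hp, rfl⟩ | hp
    · obtain ⟨k, q, rfl, hk, hq, hql⟩ := ih hl' hp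
      refine ⟨a, k :: q, rfl, le_rfl, ?_, by simpa⟩
      intro j hj
      rcases List.mem_cons.1 hj with rfl | hj
      · exact (hl b (by simp)).trans hk
      · exact hq j hj
    · obtain ⟨k, q, rfl, hk, hq, hql⟩ := ih hl' hp
      exact ⟨k, q, rfl, by omega, hq, hql.trans (by simp)⟩

/-- The sum over all box fillings that defines an interpolated multiple zeta value, with
polylogarithms in place of the multiple zeta values. -/
noncomputable def fillingSum (t : ℝ) (a : ℕ) (l : List ℕ) : PowerSeries ℝ :=
  ((boxFillingsCons a l).map fun p => t ^ (l.length + 1 - p.length) • polylog p).sum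

lemma fillingSum_cons (t : ℝ) (a b : ℕ) (l : List ℕ) (hl : ∀ j ∈ l, 1 ≤ j) :
    fillingSum t a (b :: l) =
      (formOp 1 ^ (a - 1)) (formOp geomSeries (fillingSum t b l)) + t • fillingSum t (a + b) l := by
  simp only [fillingSum, boxFillingsCons, List.map_append, List.sum_append, List.map_map,
    map_list_sum, List.smul_sum]
  congr 2
  · refine List.map_congr_left fun p _ => ?_
    simp [polylog]
  · refine List.map_congr_left fun p hp => ?_
    obtain ⟨k, q, rfl, -, -, hq⟩ := exists_eq_cons_of_mem_boxFillingsCons hl hp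
    simp only [Function.comp_apply, smul_smul, ← pow_succ', List.length_cons]
    congr 2
    omega

/-- Raising the first entry prepends letters `dz / z`, in every filling. -/
lemma fillingSum_add (t : ℝ) {a : ℕ} (ha : 1 ≤ a) (c : ℕ) (l : List ℕ) (hl : ∀ j ∈ l, 1 ≤ j) :
    fillingSum t (a + c) l = (formOp 1 ^ c) (fillingSum t a l) := by
  have hac : a + c - 1 = c + (a - 1) := by omega
  induction l generalizing a with
  | nil => simp [fillingSum, boxFillingsCons, polylog, hac, pow_add]
  | cons b l ih =>
    have hl' : ∀ j ∈ l, 1 ≤ j := fun j hj => hl j (by simp [hj])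
    rw [fillingSum_cons t _ b l hl', fillingSum_cons t _ b l hl', add_right_comm a c b,
      ih (a := a + b) (by omega) hl' (by omega), hac, pow_add, map_add, map_smul, Module.End.mul_apply]

lemma fillingSum_eq_interpolatedPolylog (t : ℝ) {a : ℕ} (ha : 1 ≤ a) (l : List ℕ)
    (hl : ∀ j ∈ l, 1 ≤ j) : fillingSum t a l = interpolatedPolylog t (a :: l) := by
  induction l generalizing a with
  | nil => simp [fillingSum, boxFillingsCons, polylog, interpolatedPolylog]
  | cons b l ih =>
    have hl' : ∀ j ∈ l, 1 ≤ j := fun j hj => hl j (by simp [hj])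
    have hb : 1 ≤ b := hl b (by simp)
    obtain ⟨a, rfl⟩ := Nat.exists_eq_add_of_le' ha
    rw [fillingSum_cons t _ b l hl', add_comm (a + 1) b, fillingSum_add t hb _ l hl',
      interpolatedPolylog, ← ih hb hl', formOp_add_smul]
    simp [pow_succ]

lemma hasSum_coeff_interpolatedPolylog (t : ℝ) {k : ℕ} (hk : 2 ≤ k) (l : List ℕ)
    (hl : ∀ j ∈ l, 1 ≤ j) :
    HasSum (fun n => PowerSeries.coeff n (interpolatedPolylog t (k :: l)))
      ((imzv (k :: l)).eval t) := by
  rw [← fillingSum_eq_interpolatedPolylog t (by omega) l hl, imzv, boxFillings, fillingSum,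
    List.length_cons]
  have h : ∀ p ∈ boxFillingsCons k l, HasSum (fun n => PowerSeries.coeff n (polylog p)) (mzv p) := by
    intro p hp
    obtain ⟨j, q, rfl, hj, hq, -⟩ := exists_eq_cons_of_mem_boxFillingsCons hl hp
    exact hasSum_coeff_polylog (hk.trans hj) q hq
  generalize boxFillingsCons k l = L at h
  induction L with
  | nil => simp [hasSum_zero]
  | cons p L ih =>
    simp only [List.map_cons, List.sum_cons, map_add, eval_add, eval_mul, eval_pow, eval_X, eval_C,
      PowerSeries.coeff_smul, smul_eq_mul]
    exact ((h p (by simp)).mul_left _).add (ih fun q hq => h q (by simp [hq]))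

/-- A linear functional on all power series that assigns to every series with summable coefficients
the sum of the coefficients. -/
def ExtendsCoeffSum (Λ : PowerSeries ℝ →ₗ[ℝ] ℝ) : Prop :=
  ∀ f s, HasSum (fun n => PowerSeries.coeff n f) s → Λ f = s

/-- Such a functional evaluates the two sides of an identity of power series term by term,
including terms with divergent coefficient sums whose weight is zero. -/
lemma exists_extendsCoeffSum : ∃ Λ, ExtendsCoeffSum Λ := by
  let V : Submodule ℝ (PowerSeries ℝ) :=
    { carrier := {f | Summable fun n => PowerSeries.coeff n f}
      zero_mem' := by simp
      add_mem' := fun hf hg => by simpa using hf.add hg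
      smul_mem' := fun c f hf => by simpa using hf.mul_left c }
  let φ : V →ₗ[ℝ] ℝ :=
    { toFun := fun f => ∑' n, PowerSeries.coeff n f.1
      map_add' := fun f g => by simpa using f.2.tsum_add g.2
      map_smul' := fun c f => by simpa using f.2.tsum_mul_left c }
  obtain ⟨Λ, hΛ⟩ := φ.exists_extend
  refine ⟨Λ, fun f s hf => ?_⟩
  rw [← hf.tsum_eq]
  exact congr($hΛ ⟨f, hf.summable⟩)

/-- The sum of the coefficients is multiplicative; summable real series converge absolutely. -/
lemma hasSum_coeff_mul {f g : PowerSeries ℝ} {s s' : ℝ}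
    (hf : HasSum (fun n => PowerSeries.coeff n f) s)
    (hg : HasSum (fun n => PowerSeries.coeff n g) s') :
    HasSum (fun n => PowerSeries.coeff n (f * g)) (s * s') := by
  have hf' := summable_norm_iff.2 hf.summable
  have hg' := summable_norm_iff.2 hg.summable
  simp only [PowerSeries.coeff_mul]
  rw [← hf.tsum_eq, ← hg.tsum_eq,
    tsum_mul_tsum_eq_tsum_sum_antidiagonal_of_summable_norm hf' hg']
  exact (summable_norm_sum_mul_antidiagonal_of_summable_norm hf' hg').of_norm.hasSum

/-! ### Sums over compositions -/

lemma sum_antidiagonalTuple_succ {M : Type*} [AddCommMonoid M] (n c : ℕ)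
    (f : (Fin (n + 1) → ℕ) → M) :
    ∑ α ∈ Finset.Nat.antidiagonalTuple (n + 1) c, f α =
      ∑ ij ∈ antidiagonal c, ∑ β ∈ Finset.Nat.antidiagonalTuple n ij.2, f (Fin.cons ij.1 β) := by
  rw [Finset.sum_sigma']
  refine Finset.sum_bij'
    (fun α _ => (⟨(α 0, ∑ i, Fin.tail α i), Fin.tail α⟩ : (_ : ℕ × ℕ) × (Fin n → ℕ)))
    (fun q _ => Fin.cons q.1.1 q.2) ?_ ?_ ?_ ?_ ?_
  · intro α hα
    rw [Finset.Nat.mem_antidiagonalTuple, Fin.sum_univ_succ] at hα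
    simp only [Finset.mem_sigma, Finset.HasAntidiagonal.mem_antidiagonal,
      Finset.Nat.mem_antidiagonalTuple, and_true]
    exact hα
  · rintro ⟨⟨i, j⟩, β⟩ h
    simp only [Finset.mem_sigma, Finset.HasAntidiagonal.mem_antidiagonal,
      Finset.Nat.mem_antidiagonalTuple] at h
    simp [Finset.Nat.mem_antidiagonalTuple, Fin.sum_univ_succ, h.1, h.2]
  · intro α _
    exact Fin.cons_self_tail α
  · rintro ⟨⟨i, j⟩, β⟩ h
    simp only [Finset.mem_sigma, Finset.HasAntidiagonal.mem_antidiagonal,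
      Finset.Nat.mem_antidiagonalTuple] at h
    simp [h.2]
  · intro α _
    simp

/-- Kronecker deltas at all positions from the `k`-th on restrict a sum over tuples to tuples that
are padded with zeros. -/
lemma sum_antidiagonalTuple_prod_kronecker {M : Type*} [AddCommMonoid M] {k N : ℕ} (h : k ≤ N)
    (c : ℕ) (f : List ℕ → M) :
    ∑ α ∈ Finset.Nat.antidiagonalTuple N c,
        (∏ j : Fin N with k ≤ j.val, kronecker (α j) 0) • f (List.ofFn α) =
      ∑ α ∈ Finset.Nat.antidiagonalTuple k c, f (List.ofFn α ++ List.replicate (N - k) 0) := by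
  induction k generalizing N c f with
  | zero =>
    cases c with
    | zero =>
      simp [Finset.Nat.antidiagonalTuple_zero_right, kronecker]
      congr 1
      exact List.ofFn_const _ _
    | succ c =>
      rw [Finset.Nat.antidiagonalTuple_zero_succ, Finset.sum_empty]
      refine Finset.sum_eq_zero fun α hα => ?_
      rw [Finset.Nat.mem_antidiagonalTuple] at hα
      obtain ⟨j, -, hj⟩ := Finset.exists_ne_zero_of_sum_ne_zero (by omega : ∑ i, α i ≠ 0)
      rw [Finset.prod_eq_zero (i := j) (by simp) (by simp [kronecker, hj]), zero_smul]
  | succ k ih =>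
    obtain ⟨N, rfl⟩ : ∃ n, N = n + 1 := ⟨N - 1, by omega⟩
    rw [sum_antidiagonalTuple_succ, sum_antidiagonalTuple_succ]
    refine Finset.sum_congr rfl fun ij _ => ?_
    simp only [List.ofFn_succ, Fin.cons_zero, Fin.cons_succ, List.cons_append,
      Nat.add_sub_add_right]
    rw [← ih (by omega) ij.2 fun L => f (ij.1 :: L)]
    refine Finset.sum_congr rfl fun β _ => ?_
    congr 1
    rw [Finset.prod_filter, Finset.prod_filter, Fin.prod_univ_succ]
    simp

/-- Below the lower limit both binomial coefficients vanish, so that the sum may start at `0`. -/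
lemma sum_Icc_intBinom (k n : ℕ) (g : ℤ → ℝ) :
    ∑ i ∈ Finset.Icc (min ((k : ℤ) + 1) (n + 1) - 1) (k + n),
        ((intBinom i k + intBinom i n : ℕ) : ℝ) * g i =
      ∑ i ∈ Finset.range (k + n + 1), ((i.choose k + i.choose n : ℕ) : ℝ) * g i := by
  have e (i m : ℕ) : intBinom i m = i.choose m := by
    unfold intBinom
    split_ifs with h
    · simp
    · rw [Nat.choose_eq_zero_of_lt]
      omega
  rw [← Finset.sum_subset (s₁ := (Finset.range (k + n + 1)).filter (fun i => min k n ≤ i))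
    (Finset.filter_subset _ _)]
  · refine Finset.sum_nbij' Int.toNat (fun i => (i : ℤ)) ?_ ?_ ?_ ?_ ?_
    · intro i hi
      simp only [Finset.mem_Icc, Finset.mem_filter, Finset.mem_range] at hi ⊢
      omega
    · intro i hi
      simp only [Finset.mem_Icc, Finset.mem_filter, Finset.mem_range] at hi ⊢
      omega
    · intro i hi
      simp only [Finset.mem_Icc] at hi
      omega
    · intro i _
      simp
    · intro i hi
      simp only [Finset.mem_Icc] at hi
      obtain ⟨j, rfl⟩ := Int.eq_ofNat_of_zero_le (show 0 ≤ i by omega)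
      simp [e]
  · intro i _ hi'
    simp only [Finset.mem_filter] at hi'
    rw [Nat.choose_eq_zero_of_lt (by simp_all), Nat.choose_eq_zero_of_lt (by simp_all)]
    simp

/-! ### Polylogarithms summed over compositions -/

section Tuples

variable (t : ℝ)

/-- Integration against `dz / (1 - z) + t dz / z`. -/
noncomputable abbrev mixedOp : Module.End ℝ (PowerSeries ℝ) := formOp (geomSeries + t • 1)

lemma formOp_geomSeries_eq : formOp geomSeries = mixedOp t - t • formOp 1 := by
  rw [mixedOp, formOp_add_smul, add_sub_cancel_right]

/-- What an index `l` contributes if it is preceded by other entries: the letter that ends the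
preceding entry, followed by the letters of `l`. -/
noncomputable def tailPolylog (l : List ℕ) : PowerSeries ℝ :=
  if l = [] then formOp geomSeries 1 else mixedOp t (interpolatedPolylog t l)

lemma interpolatedPolylog_cons (a : ℕ) (l : List ℕ) :
    interpolatedPolylog t (a :: l) = (formOp 1 ^ (a - 1)) (tailPolylog t l) := by
  cases l <;> simp [interpolatedPolylog, tailPolylog]

lemma tailPolylog_of_ne_nil {l : List ℕ} (h : l ≠ []) :
    tailPolylog t l = mixedOp t (interpolatedPolylog t l) := if_neg h

lemma tailPolylog_replicate (k : ℕ) :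
    tailPolylog t (List.replicate k 1) = (mixedOp t ^ k * formOp geomSeries) 1 := by
  induction k with
  | zero => simp [tailPolylog]
  | succ k ih =>
    rw [tailPolylog_of_ne_nil t (by simp), List.replicate_succ, interpolatedPolylog_cons, ih]
    simp [pow_succ', mul_assoc]

lemma tailPolylog_replicate_append (i k : ℕ) :
    tailPolylog t (List.replicate i 1 ++ [2] ++ List.replicate k 1) =
      (mixedOp t ^ (i + 1) * formOp 1 * mixedOp t ^ k * formOp geomSeries) 1 := by
  rw [List.append_assoc]
  induction i with
  | zero =>
    rw [tailPolylog_of_ne_nil t (by simp), List.replicate_zero, List.nil_append,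
      List.singleton_append, interpolatedPolylog_cons, tailPolylog_replicate]
    simp [mul_assoc]
  | succ i ih =>
    rw [tailPolylog_of_ne_nil t (by simp), List.replicate_succ, List.cons_append,
      interpolatedPolylog_cons, ih]
    simp [pow_succ' _ (i + 1), mul_assoc]

/-- The sum over all indices that end with a fixed part and have a given depth and weight before it
is a shuffle of letters: an index is an order of the letters. -/
lemma sum_interpolatedPolylog_append (n j e : ℕ) (l : List ℕ) :
    ∑ β ∈ Finset.Nat.antidiagonalTuple (n + 1) j, interpolatedPolylog t
        ((List.ofFn fun i : Fin n => β i.castSucc + 1) ++ [β (Fin.last n) + 1 + e] ++ l) =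
      (shuffleSum (List.replicate n (mixedOp t)) (List.replicate j (formOp 1)) * formOp 1 ^ e)
        (tailPolylog t l) := by
  induction n generalizing j with
  | zero =>
    simp [interpolatedPolylog_cons, add_right_comm, pow_add]
  | succ n ih =>
    rw [sum_antidiagonalTuple_succ, List.replicate_succ, shuffleSum_cons_replicate,
      Finset.sum_mul, LinearMap.sum_apply]
    refine Finset.sum_congr rfl fun ij _ => ?_
    simp only [mul_assoc, Module.End.mul_apply] at ih ⊢
    rw [← ih, map_sum, map_sum]
    refine Finset.sum_congr rfl fun β _ => ?_
    rw [← tailPolylog_of_ne_nil t (by simp)]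
    simp [List.ofFn_succ, interpolatedPolylog_cons, ← Fin.succ_last]

/-- The analogue of `sum_interpolatedPolylog_append` for an entry that comes from two parts of the
composition, joined by a letter `dz / z`. -/
lemma sum_interpolatedPolylog_append_merged (n j : ℕ) (l : List ℕ) :
    ∑ β ∈ Finset.Nat.antidiagonalTuple (n + 2) j, interpolatedPolylog t
        ((List.ofFn fun i : Fin n => β i.castSucc.castSucc + 1) ++
          [β (Fin.last n).castSucc + β (Fin.last (n + 1)) + 2] ++ l) =
      shuffleSum (List.replicate n (mixedOp t) ++ [formOp 1]) (List.replicate j (formOp 1))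
        (tailPolylog t l) := by
  induction n generalizing j with
  | zero =>
    rw [sum_antidiagonalTuple_succ, List.replicate_zero, List.nil_append,
      shuffleSum_cons_replicate, LinearMap.sum_apply]
    refine Finset.sum_congr rfl fun ij _ => ?_
    simp only [Finset.Nat.antidiagonalTuple_one, Finset.sum_singleton]
    simp only [interpolatedPolylog_cons, List.ofFn_zero, List.nil_append, List.singleton_append,
      shuffleSum_nil_left, List.prod_replicate]
    rw [mul_assoc, ← pow_succ', ← pow_add, ← add_assoc]
    simp [← Fin.succ_last]
  | succ n ih =>
    rw [sum_antidiagonalTuple_succ, List.replicate_succ, List.cons_append,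
      shuffleSum_cons_replicate, LinearMap.sum_apply]
    refine Finset.sum_congr rfl fun ij _ => ?_
    simp only [mul_assoc, Module.End.mul_apply] at ih ⊢
    rw [← ih, map_sum, map_sum]
    refine Finset.sum_congr rfl fun β _ => ?_
    rw [← tailPolylog_of_ne_nil t (by simp)]
    simp [List.ofFn_succ, interpolatedPolylog_cons, ← Fin.succ_last]

end Tuples

section Functional

variable {t : ℝ} {Λ : PowerSeries ℝ →ₗ[ℝ] ℝ}

/-- Interpolated multiple zeta values with first entry `i + 1`, weighted by `i.choose a` with `a > 0`:
the weight vanishes whenever the series does not converge. -/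
lemma sum_choose_mul_eval_imzv (hΛ : ExtendsCoeffSum Λ) {a : ℕ} (ha : 0 < a)
    (c n : ℕ) (F : (Fin (n + 1) → ℕ) → List ℕ) (D : ℕ → ℕ → PowerSeries ℝ)
    (hF : ∀ i β, ∃ k l, F (Fin.cons i β) = k :: l ∧ i + 1 ≤ k ∧ ∀ j ∈ l, 1 ≤ j)
    (hD : ∀ i j, ∑ β ∈ Finset.Nat.antidiagonalTuple n j,
      interpolatedPolylog t (F (Fin.cons i β)) = D i j) :
    ∑ α ∈ Finset.Nat.antidiagonalTuple (n + 1) c, ((α 0).choose a : ℝ) * (imzv (F α)).eval t =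
      ∑ ij ∈ antidiagonal c, (ij.1.choose a : ℝ) * Λ (D ij.1 ij.2) := by
  rw [sum_antidiagonalTuple_succ]
  refine Finset.sum_congr rfl fun ij _ => ?_
  rw [← hD, map_sum, Finset.mul_sum]
  refine Finset.sum_congr rfl fun β _ => ?_
  rw [Fin.cons_zero]
  rcases lt_or_ge ij.1 a with h | h
  · simp [Nat.choose_eq_zero_of_lt h]
  · obtain ⟨k, l, hkl, hk, hl⟩ := hF ij.1 β
    rw [hkl, hΛ _ _ (hasSum_coeff_interpolatedPolylog t (by omega) l hl)]

/-- The functional `B ↦ ∑ (i.choose a) Λ (x ^ i q B j)`, the sum over `i + j = c`, on families of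
operators `B`; here `x` is the letter `dz / z`. -/
noncomputable def choosePairing (Λ : PowerSeries ℝ →ₗ[ℝ] ℝ) (a c : ℕ)
    (q : Module.End ℝ (PowerSeries ℝ)) : (ℕ → Module.End ℝ (PowerSeries ℝ)) →ₗ[ℝ] ℝ where
  toFun B := ∑ ij ∈ antidiagonal c, (ij.1.choose a : ℝ) * Λ ((formOp 1 ^ ij.1 * q * B ij.2) 1)
  map_add' B B' := by simp [mul_add, Finset.sum_add_distrib]
  map_smul' s B := by simp [Finset.mul_sum, mul_left_comm]

lemma choosePairing_sub_smul (a c : ℕ) (q q' : Module.End ℝ (PowerSeries ℝ))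
    (B : ℕ → Module.End ℝ (PowerSeries ℝ)) :
    choosePairing Λ a c (q - t • q') B = choosePairing Λ a c q B - t * choosePairing Λ a c q' B := by
  simp [choosePairing, Finset.mul_sum, ← Finset.sum_sub_distrib, mul_sub, sub_mul, mul_left_comm]

lemma apply_shuffleSumFirst (a c : ℕ) (q : Module.End ℝ (PowerSeries ℝ))
    (u w : List (Module.End ℝ (PowerSeries ℝ))) :
    Λ (shuffleSumFirst (formOp 1) q a c u w 1) =
      choosePairing Λ a c q fun j => shuffleSum u (List.replicate j (formOp 1) ++ w) := by
  simp [shuffleSumFirst, choosePairing, LinearMap.sum_apply, -nsmul_eq_mul]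
  simp only [nsmul_eq_mul]

/-- Indices with an arbitrary initial part and a fixed end, in which the last entry of the initial
part is raised by `e`. -/
lemma sum_choose_append_concat (hΛ : ExtendsCoeffSum Λ) {a : ℕ} (ha : 0 < a) (c n e : ℕ)
    {l : List ℕ} (hl : ∀ j ∈ l, 1 ≤ j) {τ : Module.End ℝ (PowerSeries ℝ)}
    (hτ : tailPolylog t l = τ 1) :
    ∑ α ∈ Finset.Nat.antidiagonalTuple (n + 2) c, ((α 0).choose a : ℝ) *
        (imzv ((List.ofFn fun i : Fin (n + 1) => α i.castSucc + 1) ++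
          [α (Fin.last (n + 1)) + 1 + e] ++ l)).eval t =
      choosePairing Λ a c (mixedOp t) fun j =>
        shuffleSum (List.replicate n (mixedOp t)) (List.replicate j (formOp 1)) *
          formOp 1 ^ e * τ := by
  have e1 (i : ℕ) (β : Fin (n + 1) → ℕ) :
      (List.ofFn fun k : Fin (n + 1) =>
          (Fin.cons i β : Fin (n + 2) → ℕ) k.castSucc + 1) ++
        [(Fin.cons i β : Fin (n + 2) → ℕ) (Fin.last (n + 1)) + 1 + e] ++ l =
      (i + 1) :: ((List.ofFn fun k : Fin n => β k.castSucc + 1) ++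
        [β (Fin.last n) + 1 + e] ++ l) := by
    simp [List.ofFn_succ, ← Fin.succ_last]
  refine (sum_choose_mul_eval_imzv hΛ ha c (n + 1) _ (fun i j => (formOp 1 ^ i * mixedOp t *
    (shuffleSum (List.replicate n (mixedOp t)) (List.replicate j (formOp 1)) *
      formOp 1 ^ e * τ)) 1) ?_ ?_).trans rfl
  · intro i β
    refine ⟨_, _, e1 i β, le_rfl, ?_⟩
    simp only [List.mem_append, List.mem_ofFn, List.mem_singleton]
    rintro j ((⟨k, rfl⟩ | rfl) | h)
    · omega
    · omega
    · exact hl j h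
  · intro i j
    simp only [e1, interpolatedPolylog_cons]
    simp only [mul_assoc, Module.End.mul_apply]
    rw [← hτ]
    have := sum_interpolatedPolylog_append t n j e l
    rw [Module.End.mul_apply] at this
    rw [← this, map_sum, map_sum]
    refine Finset.sum_congr rfl fun β _ => ?_
    rw [tailPolylog_of_ne_nil t (by simp), Nat.add_sub_cancel]

lemma sum_choose_append (hΛ : ExtendsCoeffSum Λ) {a : ℕ} (ha : 0 < a) (c n : ℕ)
    {l : List ℕ} (hl : ∀ j ∈ l, 1 ≤ j) {τ : Module.End ℝ (PowerSeries ℝ)}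
    (hτ : tailPolylog t l = τ 1) :
    ∑ α ∈ Finset.Nat.antidiagonalTuple (n + 2) c, ((α 0).choose a : ℝ) *
        (imzv ((List.ofFn fun i => α i + 1) ++ l)).eval t =
      choosePairing Λ a c (mixedOp t) fun j =>
        shuffleSum (List.replicate n (mixedOp t)) (List.replicate j (formOp 1)) * τ := by
  have := sum_choose_append_concat hΛ ha c n 0 hl hτ
  simp only [pow_zero, mul_one, add_zero] at this
  rw [← this]
  refine Finset.sum_congr rfl fun α _ => ?_
  rw [List.ofFn_succ_last]

/-- Indices with a fixed end in which the two last parts of a composition have been merged into one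
entry. -/
lemma sum_choose_append_merged (hΛ : ExtendsCoeffSum Λ) {a : ℕ} (ha : 0 < a) (c n : ℕ)
    {l : List ℕ} (hl : ∀ j ∈ l, 1 ≤ j) {τ : Module.End ℝ (PowerSeries ℝ)}
    (hτ : tailPolylog t l = τ 1) :
    ∑ α ∈ Finset.Nat.antidiagonalTuple (n + 3) c, ((α 0).choose a : ℝ) *
        (imzv ((List.ofFn fun i : Fin (n + 1) => α i.castSucc.castSucc + 1) ++
          [α (Fin.last (n + 1)).castSucc + α (Fin.last (n + 2)) + 2] ++ l)).eval t =
      choosePairing Λ a c (mixedOp t) fun j =>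
        shuffleSum (List.replicate n (mixedOp t) ++ [formOp 1])
          (List.replicate j (formOp 1)) * τ := by
  have e1 (i : ℕ) (β : Fin (n + 2) → ℕ) :
      (List.ofFn fun k : Fin (n + 1) =>
          (Fin.cons i β : Fin (n + 3) → ℕ) k.castSucc.castSucc + 1) ++
        [(Fin.cons i β : Fin (n + 3) → ℕ) (Fin.last (n + 1)).castSucc +
          (Fin.cons i β : Fin (n + 3) → ℕ) (Fin.last (n + 2)) + 2] ++ l =
      (i + 1) :: ((List.ofFn fun k : Fin n => β k.castSucc.castSucc + 1) ++
        [β (Fin.last n).castSucc + β (Fin.last (n + 1)) + 2] ++ l) := by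
    simp [List.ofFn_succ, ← Fin.succ_last]
  refine (sum_choose_mul_eval_imzv hΛ ha c (n + 2) _ (fun i j => (formOp 1 ^ i * mixedOp t *
    (shuffleSum (List.replicate n (mixedOp t) ++ [formOp 1]) (List.replicate j (formOp 1)) *
      τ)) 1) ?_ ?_).trans rfl
  · intro i β
    refine ⟨_, _, e1 i β, le_rfl, ?_⟩
    simp only [List.mem_append, List.mem_ofFn, List.mem_singleton]
    rintro j ((⟨k, rfl⟩ | rfl) | h)
    · omega
    · omega
    · exact hl j h
  · intro i j
    simp only [e1, interpolatedPolylog_cons]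
    simp only [mul_assoc, Module.End.mul_apply]
    rw [← hτ, ← sum_interpolatedPolylog_append_merged t n j l, map_sum, map_sum]
    refine Finset.sum_congr rfl fun β _ => ?_
    rw [tailPolylog_of_ne_nil t (by simp), Nat.add_sub_cancel]

/-- The case in which the merged entry is the first one. -/
lemma sum_choose_merged (hΛ : ExtendsCoeffSum Λ) {a : ℕ} (ha : 0 < a) (c : ℕ)
    {l : List ℕ} (hl : ∀ j ∈ l, 1 ≤ j) {τ : Module.End ℝ (PowerSeries ℝ)}
    (hτ : tailPolylog t l = τ 1) :
    ∑ α ∈ Finset.Nat.antidiagonalTuple 2 c, ((α 0).choose a : ℝ) *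
        (imzv ((α 0 + α 1 + 2) :: l)).eval t =
      choosePairing Λ a c (formOp 1) fun j => formOp 1 ^ j * τ := by
  refine (sum_choose_mul_eval_imzv hΛ ha c 1 _ (fun i j => (formOp 1 ^ i * formOp 1 *
    (formOp 1 ^ j * τ)) 1) ?_ ?_).trans rfl
  · intro i β
    exact ⟨_, _, rfl, by simp; omega, hl⟩
  · intro i j
    rw [Finset.Nat.antidiagonalTuple_one, Finset.sum_singleton, interpolatedPolylog_cons, hτ,
      ← Module.End.mul_apply, ← mul_assoc, ← pow_succ, ← pow_add]
    simp [show i + j + 2 - 1 = i + 1 + j by omega]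

/-! ### The coefficients of the product formula -/

lemma sum_Icc_one_eq_sum_range {M : Type*} [AddCommMonoid M] (f : ℕ → M) (n : ℕ) :
    ∑ l ∈ Finset.Icc 1 n, f l = ∑ l ∈ Finset.range n, f (l + 1) := by
  induction n with
  | zero => simp
  | succ n ih => rw [Finset.sum_Icc_succ_top (by omega), Finset.sum_range_succ, ih]

/-- The leading sum of the product formula. The Kronecker deltas of the summand `l + 1` leave the
words that have no letter `x` behind their `l + 1` first letters `p`. -/
lemma sum_choose_prod_kronecker (hΛ : ExtendsCoeffSum Λ) {a : ℕ} (ha : 0 < a) (c : ℕ) {r N : ℕ}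
    (hN : 0 < N) (hr : r < N) (K : ℕ → ℕ) :
    ∑ α ∈ Finset.Nat.antidiagonalTuple N c,
        ((∑ l ∈ Finset.Icc 1 r, (α ⟨0, hN⟩).choose a * K l *
          ∏ j : Fin N with l + 2 ≤ j.val + 1, kronecker (α j) 0 : ℕ) : ℝ) *
          (imzv (List.ofFn fun j => α j + 1)).eval t =
      ∑ l ∈ Finset.range r, (K (l + 1) : ℝ) * choosePairing Λ a c (mixedOp t) fun j =>
        shuffleSum (List.replicate l (mixedOp t)) (List.replicate j (formOp 1)) *
          (mixedOp t ^ (N - l - 2) * formOp geomSeries) := by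
  simp only [sum_Icc_one_eq_sum_range, Nat.cast_sum, Finset.sum_mul]
  rw [Finset.sum_comm]
  refine Finset.sum_congr rfl fun l hl => ?_
  have hl := Finset.mem_range.1 hl
  have h := sum_antidiagonalTuple_prod_kronecker (show l + 2 ≤ N by omega) c
    fun L => (K (l + 1) : ℝ) * ((L.headD 0).choose a * (imzv (L.map (· + 1))).eval t)
  rw [Nat.sub_sub, ← sum_choose_append hΛ ha c l (l := List.replicate (N - (l + 2)) 1) (by simp)
    (tailPolylog_replicate t _), Finset.mul_sum]
  refine Eq.trans (Finset.sum_congr rfl fun α _ => ?_) (h.trans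
    (Finset.sum_congr rfl fun α _ => ?_))
  · have e1 : α ⟨0, hN⟩ = (List.ofFn α).headD 0 := by
      obtain ⟨N, rfl⟩ : ∃ n, N = n + 1 := ⟨N - 1, by omega⟩
      simp [List.ofFn_succ]
    have e2 : (List.ofFn fun j => α j + 1) = (List.ofFn α).map (· + 1) := by
      rw [List.map_ofFn]; rfl
    have e3 (j : Fin N) : l + 1 + 2 ≤ j.val + 1 ↔ l + 2 ≤ j.val := by omega
    rw [e1, e2, nsmul_eq_mul]
    simp only [e3, Nat.cast_mul]
    ring
  · simp [List.ofFn_succ, Function.comp_def]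

end Functional

/-! ### Proof of the product formula -/

section Assembly

variable {t : ℝ} {Λ : PowerSeries ℝ →ₗ[ℝ] ℝ}

/-- If the second word has no letter `p`, then both binomial coefficients are zero: the second one
because its lower entry is `-1`, the first one because `i` is too small. -/
lemma sum_choose_intBinom_eq_zero {a : ℕ} (c k r : ℕ) {M : ℤ} (hM : M = r + 1)
    (f : ∀ l, (Fin (l + 1) → ℕ) → ℤ → ℝ) :
    ∑ l ∈ Finset.Icc 1 k, ∑ α ∈ Finset.Nat.antidiagonalTuple (l + 1) c,
      ∑ i ∈ Finset.Icc (min ((r : ℤ) - l) (((1 : ℕ) : ℤ) - 1) - 1) (M - l - 3),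
        (((α 0).choose a *
          (intBinom i ((r : ℤ) - l - 1) + intBinom i (((1 : ℕ) : ℤ) - 2)) : ℕ) : ℝ) * f l α i = 0 := by
  refine Finset.sum_eq_zero fun l _ => Finset.sum_eq_zero fun α _ => Finset.sum_eq_zero
    fun i hi => ?_
  have hi := Finset.mem_Icc.1 hi
  rw [intBinom, intBinom, if_neg (by omega), if_neg (by omega)]
  simp

/-- The correction terms with an entry `2` among ones, written with words. -/
lemma sum_choose_intBinom (hΛ : ExtendsCoeffSum Λ) {a : ℕ} (ha : 0 < a) (c m n : ℕ) {M : ℤ}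
    (hM : M = m + n + 4) :
    ∑ l ∈ Finset.Icc 1 (m + 1), ∑ α ∈ Finset.Nat.antidiagonalTuple (l + 1) c,
      ∑ i ∈ Finset.Icc (min (((m + 2 : ℕ) : ℤ) - l) (((n + 2 : ℕ) : ℤ) - 1) - 1) (M - l - 3),
        (((α 0).choose a * (intBinom i (((m + 2 : ℕ) : ℤ) - l - 1) +
          intBinom i (((n + 2 : ℕ) : ℤ) - 2)) : ℕ) : ℝ) *
        (imzv ((List.ofFn fun j => α j + 1) ++ List.replicate i.toNat 1 ++ [2] ++
          List.replicate (M - l - i - 3).toNat 1)).eval t =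
      ∑ l ∈ Finset.range (m + 1), ∑ i ∈ Finset.range (m - l + n + 1),
        ((i.choose (m - l) + i.choose n : ℕ) : ℝ) * choosePairing Λ a c (mixedOp t) fun j =>
          shuffleSum (List.replicate l (mixedOp t)) (List.replicate j (formOp 1)) *
            (mixedOp t ^ (i + 1) * formOp 1 * mixedOp t ^ (m - l + n - i) *
              formOp geomSeries) := by
  rw [sum_Icc_one_eq_sum_range]
  refine Finset.sum_congr rfl fun l hl => ?_
  obtain ⟨k, rfl⟩ := Nat.exists_eq_add_of_le' (Nat.lt_succ_iff.1 (Finset.mem_range.1 hl))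
  subst hM
  rw [Finset.sum_comm, Nat.add_sub_cancel,
    show (((k + l + 2 : ℕ) : ℤ) - ((l + 1 : ℕ) : ℤ) - 1) = k by push_cast; ring,
    show (((k + l + 2 : ℕ) : ℤ) - ((l + 1 : ℕ) : ℤ)) = k + 1 by push_cast; ring,
    show (((n + 2 : ℕ) : ℤ) - 1) = n + 1 by push_cast; ring,
    show (((n + 2 : ℕ) : ℤ) - 2) = n by push_cast; ring,
    show (((k + l : ℕ) : ℤ) + n + 4 - ((l + 1 : ℕ) : ℤ) - 3) = k + n by push_cast; ring]
  have e := sum_Icc_intBinom k n fun i => ∑ α ∈ Finset.Nat.antidiagonalTuple (l + 1 + 1) c,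
    ((α 0).choose a : ℝ) * (imzv ((List.ofFn fun j => α j + 1) ++
      (List.replicate i.toNat 1 ++ [2] ++ List.replicate (k + n - i).toNat 1))).eval t
  refine Eq.trans (Finset.sum_congr rfl fun i _ => ?_) (e.trans
    (Finset.sum_congr rfl fun i hi => ?_))
  · rw [Finset.mul_sum]
    refine Finset.sum_congr rfl fun α _ => ?_
    rw [show (((k + l : ℕ) : ℤ) + n + 4 - ((l + 1 : ℕ) : ℤ) - i - 3) = k + n - i by push_cast; ring]
    simp only [Nat.cast_mul, List.append_assoc]
    ring
  · have hi := Finset.mem_range.1 hi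
    rw [show ((k : ℤ) + n - (i : ℤ)).toNat = k + n - i by omega, Int.toNat_natCast]
    rw [sum_choose_append hΛ ha c l (by simp; omega) (tailPolylog_replicate_append t i _)]

lemma choosePairing_fun_sub (a c : ℕ) (q : Module.End ℝ (PowerSeries ℝ))
    (B B' : ℕ → Module.End ℝ (PowerSeries ℝ)) :
    (choosePairing Λ a c q fun j => B j - B' j) =
      choosePairing Λ a c q B - choosePairing Λ a c q B' :=
  map_sub (choosePairing Λ a c q) B B'

lemma choosePairing_fun_smul (a c : ℕ) (q : Module.End ℝ (PowerSeries ℝ)) (s : ℝ)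
    (B : ℕ → Module.End ℝ (PowerSeries ℝ)) :
    (choosePairing Λ a c q fun j => s • B j) = s * choosePairing Λ a c q B :=
  map_smul (choosePairing Λ a c q) s B

lemma choosePairing_fun_nsmul (a c : ℕ) (q : Module.End ℝ (PowerSeries ℝ)) (k : ℕ)
    (B : ℕ → Module.End ℝ (PowerSeries ℝ)) :
    (choosePairing Λ a c q fun j => k • B j) = k * choosePairing Λ a c q B := by
  rw [← nsmul_eq_mul]
  exact map_nsmul (choosePairing Λ a c q) k B

lemma choosePairing_fun_sum (a c : ℕ) (q : Module.End ℝ (PowerSeries ℝ)) (s : Finset ℕ)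
    (B : ℕ → ℕ → Module.End ℝ (PowerSeries ℝ)) :
    (choosePairing Λ a c q fun j => ∑ l ∈ s, B l j) =
      ∑ l ∈ s, choosePairing Λ a c q fun j => B l j := by
  rw [← map_sum]
  congr 1
  funext j
  simp

/-- One half of the product formula: the contribution of the shuffles in which the first letter
other than `x` comes from the first word. -/
lemma apply_shuffleSumFirst_eq (hΛ : ExtendsCoeffSum Λ) {a : ℕ} (ha : 0 < a) (c : ℕ) {r s N : ℕ}
    {M : ℤ} (hr : 0 < r) (hs : 0 < s) (hN0 : 0 < N) (hN : N = r + s) (hM : M = r + s)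
    {q : Module.End ℝ (PowerSeries ℝ)} {u : List (Module.End ℝ (PowerSeries ℝ))}
    (hu : q :: u = List.replicate (r - 1) (mixedOp t) ++ [formOp geomSeries]) :
    Λ (shuffleSumFirst (formOp 1) q a c u
        (List.replicate (s - 1) (mixedOp t) ++ [formOp geomSeries]) 1) =
      ∑ α ∈ Finset.Nat.antidiagonalTuple N c,
        ((∑ l ∈ Finset.Icc 1 r, (α ⟨0, hN0⟩).choose a * (N - l - 1).choose (r - l) *
          ∏ j : Fin N with l + 2 ≤ j.val + 1, kronecker (α j) 0 : ℕ) : ℝ) *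
          (imzv (List.ofFn fun j => α j + 1)).eval t -
      t * (∑ l ∈ Finset.Icc 1 (r - 1), ∑ α ∈ Finset.Nat.antidiagonalTuple (l + 1) c,
        ∑ i ∈ Finset.Icc (min ((r : ℤ) - l) ((s : ℤ) - 1) - 1) (M - l - 3),
          (((α 0).choose a *
            (intBinom i ((r : ℤ) - l - 1) + intBinom i ((s : ℤ) - 2)) : ℕ) : ℝ) *
          (imzv ((List.ofFn fun j => α j + 1) ++ List.replicate i.toNat 1 ++ [2] ++
            List.replicate (M - l - i - 3).toNat 1)).eval t) -
      t * ((kronecker s 1 : ℝ) * (∑ l ∈ Finset.Icc 1 (r - 1),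
          ∑ α ∈ Finset.Nat.antidiagonalTuple (l + 1) c, ((α 0).choose a : ℝ) *
            (imzv ((List.ofFn fun j : Fin l => α j.castSucc + 1) ++ [α (Fin.last l) + 2] ++
              List.replicate (r - l - 1) 1)).eval t) +
        ∑ α ∈ Finset.Nat.antidiagonalTuple (r + 1) c, ((α 0).choose a : ℝ) *
          (imzv ((List.ofFn fun j : Fin (r - 1) => α (j.castLE (by omega)) + 1) ++
            [α ⟨r - 1, by omega⟩ + α (Fin.last r) + 2] ++
              List.replicate (s - 1) 1)).eval t) := by
  rw [sum_choose_prod_kronecker hΛ ha c hN0 (by omega) fun l => (N - l - 1).choose (r - l),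
    apply_shuffleSumFirst]
  have hy := formOp_geomSeries_eq t
  subst hN
  obtain rfl | ⟨m, rfl⟩ : r = 1 ∨ ∃ m, r = m + 2 := by
    rcases r with _ | _ | m
    exacts [absurd hr (lt_irrefl 0), .inl rfl, .inr ⟨m, rfl⟩]
  · simp only [Nat.sub_self, List.replicate_zero, List.nil_append, List.cons.injEq] at hu
    obtain ⟨rfl, rfl⟩ := hu
    have e := sum_choose_merged (t := t) hΛ ha c (l := List.replicate (s - 1) 1) (by simp)
      (tailPolylog_replicate t _)
    nth_rw 1 [hy]
    rw [choosePairing_sub_smul]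
    simp only [shuffleSum_nil_left, List.prod_append, List.prod_replicate, List.prod_singleton]
    rw [← e, Finset.sum_range_one, show 1 + s - 0 - 2 = s - 1 by omega]
    simp [Nat.choose_zero_right, Fin.last]
  · rw [show m + 2 - 1 = m + 1 from rfl, List.replicate_succ, List.cons_append,
      List.cons.injEq] at hu
    obtain ⟨rfl, rfl⟩ := hu
    have e := sum_choose_append_merged (t := t) hΛ ha c m (l := List.replicate (s - 1) 1) (by simp)
      (tailPolylog_replicate t _)
    have hmerged : ∑ α ∈ Finset.Nat.antidiagonalTuple (m + 2 + 1) c, ((α 0).choose a : ℝ) *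
          (imzv ((List.ofFn fun j : Fin (m + 2 - 1) => α (j.castLE (by omega)) + 1) ++
            [α ⟨m + 2 - 1, by omega⟩ + α (Fin.last (m + 2)) + 2] ++
              List.replicate (s - 1) 1)).eval t = _ := e
    rw [hmerged, show m + 2 - 1 = m + 1 from rfl]
    obtain rfl | ⟨n, rfl⟩ : s = 1 ∨ ∃ n, s = n + 2 := by
      rcases s with _ | _ | n
      exacts [absurd hs (lt_irrefl 0), .inl rfl, .inr ⟨n, rfl⟩]
    · have hδ : ∑ l ∈ Finset.Icc 1 (m + 1), ∑ α ∈ Finset.Nat.antidiagonalTuple (l + 1) c,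
          ((α 0).choose a : ℝ) * (imzv ((List.ofFn fun j : Fin l => α j.castSucc + 1) ++
            [α (Fin.last l) + 2] ++ List.replicate (m + 2 - l - 1) 1)).eval t =
          ∑ l ∈ Finset.range (m + 1), choosePairing Λ a c (mixedOp t) fun j =>
            shuffleSum (List.replicate l (mixedOp t)) (List.replicate j (formOp 1)) * formOp 1 *
              mixedOp t ^ (m - l) * formOp geomSeries := by
        rw [sum_Icc_one_eq_sum_range]
        refine Finset.sum_congr rfl fun l _ => ?_
        rw [show m + 2 - (l + 1) - 1 = m - l by omega]
        have e2 := sum_choose_append_concat (t := t) hΛ ha c l 1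
          (l := List.replicate (m - l) 1) (by simp) (tailPolylog_replicate t _)
        simpa only [pow_one, ← mul_assoc] using e2
      rw [sum_choose_intBinom_eq_zero c (m + 1) (m + 2) hM, hδ]
      simp only [Nat.sub_self, List.replicate_zero, List.nil_append,
        shuffleSum_concat_append_singleton hy, choosePairing_fun_sub, choosePairing_fun_smul,
        choosePairing_fun_sum]
      have hmain : ∀ l ∈ Finset.range (m + 2),
          ((m + 2 + 1 - (l + 1) - 1).choose (m + 2 - (l + 1)) : ℝ) *
            (choosePairing Λ a c (mixedOp t) fun j =>
              shuffleSum (List.replicate l (mixedOp t)) (List.replicate j (formOp 1)) *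
                (mixedOp t ^ (m + 2 + 1 - l - 2) * formOp geomSeries)) =
          choosePairing Λ a c (mixedOp t) fun j =>
            shuffleSum (List.replicate l (mixedOp t)) (List.replicate j (formOp 1)) *
              mixedOp t ^ (m + 1 - l) * formOp geomSeries := by
        intro l hl
        have hl := Finset.mem_range.1 hl
        rw [show m + 2 + 1 - (l + 1) - 1 = m + 1 - l by omega,
          show m + 2 - (l + 1) = m + 1 - l by omega, show m + 2 + 1 - l - 2 = m + 1 - l by omega,
          Nat.choose_self, Nat.cast_one, one_mul]
        simp only [mul_assoc]
      rw [Finset.sum_congr rfl hmain]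
      simp only [kronecker, if_true, Nat.cast_one, one_mul, pow_zero]
      ring
    · rw [sum_choose_intBinom hΛ ha c m n (by rw [hM]; push_cast; ring)]
      rw [show n + 2 - 1 = n + 1 from rfl]
      simp only [shuffleSum_concat_append_succ hy, choosePairing_fun_sub, choosePairing_fun_smul,
        choosePairing_fun_sum, choosePairing_fun_nsmul]
      have hmain : ∀ l ∈ Finset.range (m + 2),
          ((m + 2 + (n + 2) - (l + 1) - 1).choose (m + 2 - (l + 1)) : ℝ) *
            (choosePairing Λ a c (mixedOp t) fun j =>
              shuffleSum (List.replicate l (mixedOp t)) (List.replicate j (formOp 1)) *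
                (mixedOp t ^ (m + 2 + (n + 2) - l - 2) * formOp geomSeries)) =
          ((m + n + 2 - l).choose (m + 1 - l) : ℝ) * choosePairing Λ a c (mixedOp t) fun j =>
            shuffleSum (List.replicate l (mixedOp t)) (List.replicate j (formOp 1)) *
              mixedOp t ^ (m + n + 2 - l) * formOp geomSeries := by
        intro l hl
        have hl := Finset.mem_range.1 hl
        rw [show m + 2 + (n + 2) - (l + 1) - 1 = m + n + 2 - l by omega,
          show m + 2 - (l + 1) = m + 1 - l by omega,
          show m + 2 + (n + 2) - l - 2 = m + n + 2 - l by omega]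
        simp only [mul_assoc]
      rw [Finset.sum_congr rfl hmain]
      simp only [kronecker, mul_assoc]
      simp

end Assembly

theorem theorem2 (a b r s : ℕ) (ha : 0 < a) (hb : 0 < b) (hr : 0 < r) (hs : 0 < s) :
    imzv ((a + 1) :: List.replicate (r - 1) 1) * imzv ((b + 1) :: List.replicate (s - 1) 1) =
      (∑ α ∈ Finset.Nat.antidiagonalTuple (r + s) (a + b),
        (((∑ l ∈ Finset.Icc 1 r,
              (α ⟨0, by omega⟩).choose a * (r + s - l - 1).choose (r - l) *
                ∏ j : Fin (r + s) with l + 2 ≤ j.val + 1, kronecker (α j) 0) +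
            ∑ l ∈ Finset.Icc 1 s,
              (α ⟨0, by omega⟩).choose b * (r + s - l - 1).choose (s - l) *
                ∏ j : Fin (r + s) with l + 2 ≤ j.val + 1, kronecker (α j) 0 : ℕ) : ℝ[X]) *
          imzv (List.ofFn fun j => α j + 1))
      - X *
        ((∑ l ∈ Finset.Icc 1 (r - 1), ∑ α ∈ Finset.Nat.antidiagonalTuple (l + 1) (a + b),
            ∑ i ∈ Finset.Icc (min ((r : ℤ) - l) ((s : ℤ) - 1) - 1) ((r : ℤ) + s - l - 3),
              (((α 0).choose a *
                  (intBinom i ((r : ℤ) - l - 1) + intBinom i ((s : ℤ) - 2)) : ℕ) : ℝ[X]) *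
                imzv ((List.ofFn fun j => α j + 1) ++ List.replicate i.toNat 1 ++ [2] ++
                  List.replicate ((r : ℤ) + s - l - i - 3).toNat 1)) +
          ∑ l ∈ Finset.Icc 1 (s - 1), ∑ α ∈ Finset.Nat.antidiagonalTuple (l + 1) (a + b),
            ∑ i ∈ Finset.Icc (min ((r : ℤ) - 1) ((s : ℤ) - l) - 1) ((r : ℤ) + s - l - 3),
              (((α 0).choose b *
                  (intBinom i ((s : ℤ) - l - 1) + intBinom i ((r : ℤ) - 2)) : ℕ) : ℝ[X]) *
                imzv ((List.ofFn fun j => α j + 1) ++ List.replicate i.toNat 1 ++ [2] ++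
                  List.replicate ((r : ℤ) + s - l - i - 3).toNat 1))
      - X *
        ((kronecker s 1 : ℝ[X]) *
            (∑ l ∈ Finset.Icc 1 (r - 1), ∑ α ∈ Finset.Nat.antidiagonalTuple (l + 1) (a + b),
              ((α 0).choose a : ℝ[X]) *
                imzv ((List.ofFn fun j : Fin l => α j.castSucc + 1) ++ [α (Fin.last l) + 2] ++
                  List.replicate (r - l - 1) 1)) +
          (kronecker r 1 : ℝ[X]) *
            (∑ l ∈ Finset.Icc 1 (s - 1), ∑ α ∈ Finset.Nat.antidiagonalTuple (l + 1) (a + b),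
              ((α 0).choose b : ℝ[X]) *
                imzv ((List.ofFn fun j : Fin l => α j.castSucc + 1) ++ [α (Fin.last l) + 2] ++
                  List.replicate (s - l - 1) 1)) +
          (∑ α ∈ Finset.Nat.antidiagonalTuple (r + 1) (a + b),
            ((α 0).choose a : ℝ[X]) *
              imzv ((List.ofFn fun j : Fin (r - 1) => α (j.castLE (by omega)) + 1) ++
                [α ⟨r - 1, by omega⟩ + α (Fin.last r) + 2] ++ List.replicate (s - 1) 1)) +
          ∑ α ∈ Finset.Nat.antidiagonalTuple (s + 1) (a + b),
            ((α 0).choose b : ℝ[X]) *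
              imzv ((List.ofFn fun j : Fin (s - 1) => α (j.castLE (by omega)) + 1) ++
                [α ⟨s - 1, by omega⟩ + α (Fin.last s) + 2] ++ List.replicate (r - 1) 1)) := by
  -- it suffices to compare the values of both polynomials at every real `t`
  refine Polynomial.funext fun t => ?_
  obtain ⟨Λ, hΛ⟩ := exists_extendsCoeffSum
  have hconv (a r : ℕ) (ha : 0 < a) : HasSum (fun n => PowerSeries.coeff n
      (interpolatedPolylog t ((a + 1) :: List.replicate (r - 1) 1)))
      ((imzv ((a + 1) :: List.replicate (r - 1) 1)).eval t) :=
    hasSum_coeff_interpolatedPolylog t (by omega) _ (by simp)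
  have hword (a r : ℕ) : interpolatedPolylog t ((a + 1) :: List.replicate (r - 1) 1) =
      ((List.replicate a 1 ++ (List.replicate (r - 1) (geomSeries + t • 1) ++
        [geomSeries])).map formOp).prod 1 := by
    rw [interpolatedPolylog_cons, tailPolylog_replicate]
    simp
  rw [eval_mul, ← hΛ _ _ (hasSum_coeff_mul (hconv a r ha) (hconv b s hb)), hword, hword,
    prod_formOp_mul_prod_formOp _ _ (by simp [geomSeries]) (by simp [geomSeries])]
  have hne (r : ℕ) : ∃ q u, List.replicate (r - 1) (mixedOp t) ++ [formOp geomSeries] = q :: u :=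
    List.exists_cons_of_ne_nil (by simp)
  obtain ⟨q, u, hu⟩ := hne r
  obtain ⟨q', v, hv⟩ := hne s
  simp only [List.map_append, List.map_replicate, List.map_cons, List.map_nil]
  rw [hu, hv, shuffleSum_replicate_append, LinearMap.add_apply, map_add, ← hu, ← hv,
    apply_shuffleSumFirst_eq hΛ ha (a + b) (N := r + s) (M := r + s) hr hs (by omega) rfl rfl
      hu.symm,
    apply_shuffleSumFirst_eq hΛ hb (a + b) (N := r + s) (M := r + s) hs hr (by omega)
      (add_comm r s) (add_comm _ _) hv.symm]
  simp only [eval_add, eval_sub, eval_mul, eval_X, eval_finsetSum, eval_natCast, Nat.cast_add,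
    add_mul, Finset.sum_add_distrib]
  simp only [min_comm ((s : ℤ) - _)]
  ring
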